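/- Let $(\Lambda,\Lambda^*,R,R^*)$ be a reduced semisimple root datum with simple roots $\alpha_1,\dots,\alpha_r$, $r=\operatorname{rank}\Lambda$, simple reflections $s_i$, Weyl group $W$ with length function $\ell$, and longest element $w_0$. Let $H_{t_1,t_2}(W)$ be the $\mathbb Z[t_1,t_2]$-algebra with generators $h_1,\dots,h_r$ and relations $(h_i-t_1)(h_i-t_2)=0$ and $h_ih_j\cdots=h_jh_i\cdots$ ($m_{ij}$ factors on each side, $m_{ij}$ the order of $s_is_j$, $i\ne j$). Put $Q_{t_1,t_2}(\Lambda)=\mathbb Z[t_1,t_2]\otimes Q(\mathbb Z[\Lambda])$, where $Q(\mathbb Z[\Lambda])$ is the quotient field of the group ring of $\Lambda$, and $H=Q_{t_1,t_2}(\Lambda)\otimes_{\mathbb Z[t_1,t_2]}H_{t_1,t_2}(W)$. For $w\in W$ put $h_w=h_{i_1}\cdots h_{i_\ell}$, where $w=s_{i_1}\cdots s_{i_\ell}$ is a reduced expression. With $E(\lambda)=e^{-\lambda}-1$, define $Y_w\in H$ recursively by $Y_e=1$ and $Y_w=Y_{w'}\bigl(h_i+\frac{t_1+t_2}{E(w'\alpha_i)}\bigr)$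 if $w=w's_i$ and $\ell(w)>\ell(w')$. Let $W$ act on $Q_{t_1,t_2}(\Lambda)$ by $w(e^\lambda)=e^{w\lambda}$, and let $\star$ be the ring endomorphism of $Q_{t_1,t_2}(\Lambda)$ with $\star(e^\lambda)=e^{-\lambda}$, both fixing $t_1,t_2$; let $W$ and $\star$ act on $H$ through the coefficients only, fixing every $h_w$. Then $\{h_w\}_{w\in W}$ is a $Q_{t_1,t_2}(\Lambda)$-basis of $H$, there is a (unique) $Q_{t_1,t_2}(\Lambda)$-algebra automorphism $\Omega$ of $H$ with $\Omega(h_w)=h_{w_0ww_0}$ for all $w\in W$, and for all $v\in W$ $$\Omega(Y_{w_0vw_0})=\star[w_0(Y_v)].$$ Consequently, if the coefficients $p(w,v)\in Q_{t_1,t_2}(\Lambda)$ are defined by $Y_v=\sum_{w\in W}p(w,v)\,h_w$, then for all $w,v\in W$ $$p(w_0ww_0,w_0vw_0)=\star[w_0\,p(w,v)].$$ -/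

import Mathlib

open scoped TensorProduct

noncomputable section

namespace YangBaxter

/-! ## Coefficients -/

section Coefficients

/-- The ring `ℤ[t₁, t₂]` of polynomials in two parameters. -/
abbrev ParamRing : Type := MvPolynomial (Fin 2) ℤ

/-- The first parameter `t₁`. -/
def t₁ : ParamRing := MvPolynomial.X 0

/-- The second parameter `t₂`. -/
def t₂ : ParamRing := MvPolynomial.X 1

/-- The group ring of a free abelian group is a domain. -/
instance instIsDomainGroupRing (Λ : Type*) [AddCommGroup Λ] [Module.Free ℤ Λ] :
    IsDomain (AddMonoidAlgebra ℤ Λ) := by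
  have : TwoUniqueSums Λ :=
    TwoUniqueSums.of_injective_addHom
      (Module.Free.chooseBasis ℤ Λ).repr.toAddEquiv.toAddMonoidHom.toAddHom
      (Module.Free.chooseBasis ℤ Λ).repr.injective inferInstance
  infer_instance

/-- The quotient field `Q(ℤ[Λ])` of the group ring of `Λ`. -/
def FracGroupRing (Λ : Type*) [AddCommGroup Λ] : Type _ :=
  FractionRing (AddMonoidAlgebra ℤ Λ)

instance (Λ : Type*) [AddCommGroup Λ] [Module.Free ℤ Λ] : Field (FracGroupRing Λ) :=
  inferInstanceAs (Field (FractionRing (AddMonoidAlgebra ℤ Λ)))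

instance (Λ : Type*) [AddCommGroup Λ] [Module.Free ℤ Λ] :
    Algebra (AddMonoidAlgebra ℤ Λ) (FracGroupRing Λ) :=
  inferInstanceAs (Algebra (AddMonoidAlgebra ℤ Λ) (FractionRing (AddMonoidAlgebra ℤ Λ)))

instance (Λ : Type*) [AddCommGroup Λ] [Module.Free ℤ Λ] :
    IsFractionRing (AddMonoidAlgebra ℤ Λ) (FracGroupRing Λ) :=
  inferInstanceAs (IsFractionRing (AddMonoidAlgebra ℤ Λ) (FractionRing (AddMonoidAlgebra ℤ Λ)))

/-- `Q_{t₁,t₂}(Λ) = ℤ[t₁, t₂] ⊗ Q(ℤ[Λ])`. -/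
def CoeffRing (Λ : Type*) [AddCommGroup Λ] [Module.Free ℤ Λ] : Type _ :=
  ParamRing ⊗[ℤ] FracGroupRing Λ

instance (Λ : Type*) [AddCommGroup Λ] [Module.Free ℤ Λ] : CommRing (CoeffRing Λ) :=
  inferInstanceAs (CommRing (ParamRing ⊗[ℤ] FracGroupRing Λ))

instance (Λ : Type*) [AddCommGroup Λ] [Module.Free ℤ Λ] : Algebra ParamRing (CoeffRing Λ) :=
  inferInstanceAs (Algebra ParamRing (ParamRing ⊗[ℤ] FracGroupRing Λ))

/-- `e^λ`, as an element of `Q(ℤ[Λ])`. -/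
def expo {Λ : Type*} [AddCommGroup Λ] [Module.Free ℤ Λ] (l : Λ) : FracGroupRing Λ :=
  algebraMap (AddMonoidAlgebra ℤ Λ) (FracGroupRing Λ) (AddMonoidAlgebra.single l 1)

/-- `E(λ) = e^{-λ} - 1`. -/
def E {Λ : Type*} [AddCommGroup Λ] [Module.Free ℤ Λ] (l : Λ) : FracGroupRing Λ := expo (-l) - 1

/-- The element `(t₁ + t₂) / E(λ)` of `Q_{t₁,t₂}(Λ)`. -/
def shift {Λ : Type*} [AddCommGroup Λ] [Module.Free ℤ Λ] (l : Λ) : CoeffRing Λ :=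
  ((t₁ + t₂) ⊗ₜ[ℤ] (E l)⁻¹ : ParamRing ⊗[ℤ] FracGroupRing Λ)

/-- The automorphism of `Q(ℤ[Λ])` with `e^λ ↦ e^{φ λ}`, for an automorphism `φ` of `Λ`. -/
def fracAct {Λ : Type*} [AddCommGroup Λ] [Module.Free ℤ Λ] (φ : Λ ≃+ Λ) : FracGroupRing Λ ≃+* FracGroupRing Λ :=
  IsFractionRing.ringEquivOfRingEquiv (AddMonoidAlgebra.domCongr ℤ ℤ φ).toRingEquiv

/-- The `ℤ[t₁, t₂]`-algebra endomorphism of `Q_{t₁,t₂}(Λ)` with `e^λ ↦ e^{φ λ}`. -/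
def coeffAct {Λ : Type*} [AddCommGroup Λ] [Module.Free ℤ Λ] (φ : Λ ≃+ Λ) : CoeffRing Λ →ₐ[ParamRing] CoeffRing Λ :=
  (Algebra.TensorProduct.map (AlgHom.id ParamRing ParamRing) (fracAct φ).toRingHom.toIntAlgHom :
    ParamRing ⊗[ℤ] FracGroupRing Λ →ₐ[ParamRing] ParamRing ⊗[ℤ] FracGroupRing Λ)

/-- The ring homomorphism `⋆` of `Q_{t₁,t₂}(Λ)`: it fixes `t₁`, `t₂` and sends `e^λ` to `e^{-λ}`. -/
def star (Λ : Type*) [AddCommGroup Λ] [Module.Free ℤ Λ] : CoeffRing Λ →ₐ[ParamRing] CoeffRing Λ :=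
  coeffAct (AddEquiv.neg Λ)

end Coefficients

/-! ## The Weyl group -/

section Weyl

variable {ι Λ Λ' : Type*} [AddCommGroup Λ] [Module.Free ℤ Λ] [AddCommGroup Λ'] {P : RootDatum ι Λ Λ'} (b : P.Base)

/-- The action of the Weyl group on `Q_{t₁,t₂}(Λ)`: it fixes `t₁`, `t₂`, and
`w (e^λ) = e^{w λ}`. -/
def weylAct (w : P.weylGroup) : CoeffRing Λ →ₐ[ParamRing] CoeffRing Λ :=
  coeffAct (DistribMulAction.toAddEquiv Λ w)

/-- The simple reflection `s_i`. -/
def simpleRefl (i : b.support) : P.weylGroup := RootPairing.weylGroup.ofIdx P i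

/-- The product `s_{i₁} ⋯ s_{i_k}` of simple reflections given by a word. -/
def wordProd (l : List b.support) : P.weylGroup := (l.map (simpleRefl b)).prod

/-- The length of `w`: the least number of simple reflections in an expression of `w`. -/
def length (w : P.weylGroup) : ℕ :=
  sInf {n | ∃ l : List b.support, wordProd b l = w ∧ l.length = n}

/-- A reduced expression of `w`: one with the least number of simple reflections. -/
def IsReducedWord (l : List b.support) (w : P.weylGroup) : Prop :=
  wordProd b l = w ∧ l.length = length b w

/-- A reduced expression of `w`. -/
def reducedWord (w : P.weylGroup) : List b.support :=
  Classical.epsilon fun l => IsReducedWord b l w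

end Weyl

/-! ## The generic Hecke algebra -/

section Hecke

/-- The alternating product `x y x ⋯` with `n` factors. -/
def altProd {A : Type*} [Monoid A] : A → A → ℕ → A
  | _, _, 0 => 1
  | x, y, n + 1 => x * altProd y x n

variable {ι Λ Λ' : Type*} [AddCommGroup Λ] [Module.Free ℤ Λ] [AddCommGroup Λ'] {P : RootDatum ι Λ Λ'} (b : P.Base)

/-- The defining relations of the generic Hecke algebra: `(h_i - t₁) (h_i - t₂) = 0`, and
`h_i h_j ⋯ = h_j h_i ⋯` with `m_{ij}` factors on both sides, where `m_{ij}` is the order of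
`s_i s_j`. -/
inductive HeckeRel : FreeAlgebra ParamRing b.support → FreeAlgebra ParamRing b.support → Prop
  | quadratic (i : b.support) :
      HeckeRel
        ((FreeAlgebra.ι ParamRing i - algebraMap ParamRing _ t₁) *
          (FreeAlgebra.ι ParamRing i - algebraMap ParamRing _ t₂)) 0
  | braid (i j : b.support) (hij : i ≠ j) :
      HeckeRel
        (altProd (FreeAlgebra.ι ParamRing i) (FreeAlgebra.ι ParamRing j)
          (orderOf (simpleRefl b i * simpleRefl b j)))
        (altProd (FreeAlgebra.ι ParamRing j) (FreeAlgebra.ι ParamRing i)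
          (orderOf (simpleRefl b i * simpleRefl b j)))

/-- The generic Hecke algebra `H_{t₁,t₂}(W)` over `ℤ[t₁, t₂]`. -/
def GenericHecke : Type _ := RingQuot (HeckeRel b)

instance : Ring (GenericHecke b) := inferInstanceAs (Ring (RingQuot (HeckeRel b)))

instance : Algebra ParamRing (GenericHecke b) :=
  inferInstanceAs (Algebra ParamRing (RingQuot (HeckeRel b)))

/-- The generator `h_i` of `H_{t₁,t₂}(W)`. -/
def gen (i : b.support) : GenericHecke b :=
  RingQuot.mkAlgHom ParamRing (HeckeRel b) (FreeAlgebra.ι ParamRing i)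

/-- `H^{Q(Λ)}_{t₁,t₂}(W) = Q_{t₁,t₂}(Λ) ⊗_{ℤ[t₁,t₂]} H_{t₁,t₂}(W)`. -/
def Hecke : Type _ := CoeffRing Λ ⊗[ParamRing] GenericHecke b

instance : Ring (Hecke b) := inferInstanceAs (Ring (CoeffRing Λ ⊗[ParamRing] GenericHecke b))

instance : Algebra (CoeffRing Λ) (Hecke b) :=
  inferInstanceAs (Algebra (CoeffRing Λ) (CoeffRing Λ ⊗[ParamRing] GenericHecke b))

/-- `h_i`, as an element of `H^{Q(Λ)}_{t₁,t₂}(W)`. -/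
def hSimple (i : b.support) : Hecke b :=
  (1 ⊗ₜ[ParamRing] gen b i : CoeffRing Λ ⊗[ParamRing] GenericHecke b)

/-- `h_w = h_{i₁} ⋯ h_{i_ℓ}` for a reduced expression `w = s_{i₁} ⋯ s_{i_ℓ}`. -/
def h (w : P.weylGroup) : Hecke b := ((reducedWord b w).map (hSimple b)).prod

/-- The map induced on `H^{Q(Λ)}_{t₁,t₂}(W)` by an endomorphism `f` of the coefficient ring
`Q_{t₁,t₂}(Λ)`: `f` acts on the coefficients only, that is, `c h_w ↦ f(c) h_w`. -/
def onCoeffs (f : CoeffRing Λ →ₐ[ParamRing] CoeffRing Λ) : Hecke b →+* Hecke b :=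
  ((Algebra.TensorProduct.map f (AlgHom.id ParamRing (GenericHecke b))).toRingHom :
    CoeffRing Λ ⊗[ParamRing] GenericHecke b →+* CoeffRing Λ ⊗[ParamRing] GenericHecke b)

/-- The Yang-Baxter basis: `Y_e = 1` and
`Y_w = Y_{w'} (h_i + (t₁ + t₂) / E(w' α_i))` if `w = w' s_i` and `ℓ(w') < ℓ(w)`.
Here `w' = w s_i` because `s_i` is an involution, and such an `i` exists unless `w = e`. -/
def Y (w : P.weylGroup) : Hecke b :=
  open Classical in
  if hw : ∃ i : b.support, length b (w * simpleRefl b i) < length b w then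
    Y (w * simpleRefl b hw.choose) *
      (hSimple b hw.choose +
        algebraMap (CoeffRing Λ) (Hecke b)
          (shift ((w * simpleRefl b hw.choose) • P.root hw.choose)))
  else 1
termination_by length b w
decreasing_by exact hw.choose_spec

end Hecke

end YangBaxter

end

noncomputable section

/-! The identity for Ω follows by induction on ℓ(v). If v = v's_i with ℓ(v') < ℓ(v), then w₀vw₀ =
(w₀v'w₀)s_{i*}, where α_{i*} = -w₀α_i, and (w₀v'w₀)α_{i*} = -w₀v'α_i. So Ω turns the last factor of
Y_{w₀vw₀} into h_i + (t₁+t₂)/E(-w₀v'α_i), which is what ⋆w₀ makes of the last factor of Y_v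
(`longestHom_Y`). This needs Y_v to be independent of the chosen descents (`Y_eq_mul`), and the
statement on coefficients needs {h_w} to be a basis.

Both facts come from one representation. Let h_i act on Q_{t₁,t₂}(Λ) by the Demazure–Lusztig
operator T_i, and let coefficients multiply after the operators. A shifted factor then turns an
operator B·w into a multiple of w s_i (`evalOperator_mul_shift`), so Y_w acts as a nonzero scalar
times w, whatever reduced word is used (`heckeEval_Y`). Distinct w are linearly independent by
Dedekind, hence so are the Y_w. As the h_w span, they form a basis and the evaluation is injective.

That the T_i satisfy the braid relations is deduced from a Yang–Baxter identity
(`shiftedProd_altWord_sub`): when only the quadratic relations are assumed, the two shifted products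
of a rank two system differ by exactly the difference of the two braid words. For the T_i the
shifted products act by the same operator, so the braid words agree. -/

namespace YangBaxter

/-! ### Weyl group action on roots and coroots -/

section WeylGroup

variable {ι Λ Λ' : Type*} [AddCommGroup Λ] [AddCommGroup Λ']
  {P : RootDatum ι Λ Λ'}

lemma root_smul (w : P.weylGroup) (k : ι) : P.root (w • k) = w • P.root k :=
  RootPairing.Equiv.root_indexEquiv_eq_smul P k (w : P.Aut)

lemma ofIdx_smul_idx (k l : ι) :
    RootPairing.weylGroup.ofIdx P k • l = P.reflectionPerm k l := by
  apply P.root.injective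
  rw [root_smul, P.root_reflectionPerm]
  rfl

lemma eq_of_smul_eq {w w' : P.weylGroup} (h : ∀ x : Λ, w • x = w' • x) : w = w' := by
  apply Subtype.ext
  apply RootPairing.Equiv.weightHom_injective P
  ext x
  exact h x

lemma ofIdx_mul_self (k : ι) :
    RootPairing.weylGroup.ofIdx P k * RootPairing.weylGroup.ofIdx P k = 1 := by
  apply eq_of_smul_eq
  intro x
  rw [mul_smul, one_smul]
  exact P.reflection_same k x

lemma ofIdx_smul_apply (k : ι) (x : Λ) :
    RootPairing.weylGroup.ofIdx P k • x = x - P.coroot' k x • P.root k :=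
  P.reflection_apply k x

lemma ofIdx_smul_root (k l : ι) :
    RootPairing.weylGroup.ofIdx P k • P.root l = P.root l - P.pairing l k • P.root k :=
  P.reflection_apply_root k l

lemma coroot'_smul (w : P.weylGroup) (k : ι) (x : Λ) :
    P.coroot' (w • k) (w • x) = P.coroot' k x := by
  have h1 := RootPairing.Hom.weight_coweight_transpose_apply P P (P.coroot (w • k))
    (w : P.Aut).toHom
  have h2 := RootPairing.Hom.coroot_coweightMap_apply P P (w • k) (w : P.Aut).toHom
  have h3 : (w : P.Aut).toHom.indexEquiv.symm (w • k) = k :=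
    (w : P.Aut).indexEquiv.symm_apply_apply k
  rw [h2, h3] at h1
  exact LinearMap.congr_fun h1 x

/-- The rule w s_β w⁻¹ = s_{wβ}: the pairing of roots with coroots is W-invariant, so the reflection
formulas match. -/
lemma ofIdx_smul_conj (w : P.weylGroup) (k : ι) :
    RootPairing.weylGroup.ofIdx P (w • k) * w = w * RootPairing.weylGroup.ofIdx P k := by
  apply eq_of_smul_eq
  intro x
  rw [mul_smul, mul_smul, ofIdx_smul_apply, ofIdx_smul_apply, coroot'_smul, root_smul,
    smul_sub, smul_comm w]

end WeylGroup

/-! ### Length, descents and the exchange condition -/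

section Length

variable {ι Λ Λ' : Type*} [AddCommGroup Λ] [AddCommGroup Λ']
  {P : RootDatum ι Λ Λ'} (b : P.Base)

lemma simpleRefl_mul_self (i : b.support) : simpleRefl b i * simpleRefl b i = 1 :=
  ofIdx_mul_self _

@[simp]
lemma mul_simpleRefl_cancel (w : P.weylGroup) (i : b.support) :
    w * simpleRefl b i * simpleRefl b i = w := by
  rw [mul_assoc, simpleRefl_mul_self, mul_one]

lemma simpleRefl_inv (i : b.support) : (simpleRefl b i)⁻¹ = simpleRefl b i :=
  inv_eq_of_mul_eq_one_left (simpleRefl_mul_self b i)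

@[simp] lemma wordProd_nil : wordProd b [] = 1 := rfl

@[simp] lemma wordProd_cons (i : b.support) (l : List b.support) :
    wordProd b (i :: l) = simpleRefl b i * wordProd b l := by
  simp [wordProd]

@[simp] lemma wordProd_append (l l' : List b.support) :
    wordProd b (l ++ l') = wordProd b l * wordProd b l' := by
  simp [wordProd]

lemma wordProd_reverse (l : List b.support) : wordProd b l.reverse = (wordProd b l)⁻¹ := by
  induction l with
  | nil => simp
  | cons i l ih => simp [ih, simpleRefl_inv]

-- Since -β = β - 2β, the height changes sign, and no root has height zero.
variable {b} in
lemma isPos_iff_not_of_root_eq_neg {k k' : ι} (h : P.root k' = -P.root k) :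
    b.IsPos k' ↔ ¬ b.IsPos k := by
  have h1 : P.root k' = P.root k + (-2 : ℤ) • P.root k := by rw [h]; module
  have h2 := b.height_add_zsmul h1
  have h3 := b.height_ne_zero k
  rw [b.isPos_iff, b.isPos_iff, h2, smul_eq_mul]
  lia

lemma isPos_support (i : b.support) : b.IsPos i :=
  RootPairing.Base.isPos_of_mem_support i.2

lemma root_simpleRefl_smul_self (i : b.support) :
    P.root (simpleRefl b i • (i : ι)) = -P.root i := by
  rw [root_smul, simpleRefl, ofIdx_smul_root, P.pairing_same]
  module

lemma isPos_mul_simpleRefl_smul_self (w : P.weylGroup) (i : b.support) :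
    b.IsPos ((w * simpleRefl b i) • (i : ι)) ↔ ¬ b.IsPos (w • (i : ι)) := by
  apply isPos_iff_not_of_root_eq_neg
  rw [mul_smul, root_smul, root_simpleRefl_smul_self, smul_neg, root_smul]

variable [Finite ι] [P.IsReduced]

variable {b} in
lemma isPos_simpleRefl_smul {k : ι} (hk : b.IsPos k) {i : b.support} (hki : k ≠ i) :
    b.IsPos (simpleRefl b i • k) := by
  rw [simpleRefl, ofIdx_smul_idx]
  exact hk.reflectionPerm i.2 hki

/-- W is generated by all reflections, and every root is reached from simple ones by simple
reflections and negation, so every reflection is a conjugate of a simple one by a word. -/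
lemma exists_wordProd_eq (w : P.weylGroup) : ∃ l, wordProd b l = w := by
  obtain ⟨w, hw⟩ := w
  induction hw using RootPairing.weylGroup.induction with
  | mem k =>
    change ∃ l, wordProd b l = RootPairing.weylGroup.ofIdx P k
    refine b.induction_reflect k (p := fun k ↦ ∃ l, wordProd b l = RootPairing.weylGroup.ofIdx P k)
      ?_ ?_ ?_
    · rintro k ⟨l, hl⟩
      refine ⟨l, ?_⟩
      have := ofIdx_smul_conj (RootPairing.weylGroup.ofIdx P k) k
      rw [mul_right_cancel_iff, ofIdx_smul_idx] at this
      rw [hl, this]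
    · intro i hi
      exact ⟨[⟨i, hi⟩], by simp [simpleRefl]⟩
    · rintro k j ⟨l, hl⟩ hj
      refine ⟨⟨j, hj⟩ :: (l ++ [⟨j, hj⟩]), ?_⟩
      have := ofIdx_smul_conj (RootPairing.weylGroup.ofIdx P j) k
      rw [ofIdx_smul_idx] at this
      rw [wordProd_cons, wordProd_append, hl, wordProd_cons, wordProd_nil, mul_one, simpleRefl,
        ← mul_assoc, ← this, mul_assoc, ofIdx_mul_self, mul_one]
  | one => exact ⟨[], rfl⟩
  | mul x y hx hy h1 h2 =>
    obtain ⟨l1, h1⟩ := h1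
    obtain ⟨l2, h2⟩ := h2
    exact ⟨l1 ++ l2, by rw [wordProd_append, h1, h2]; rfl⟩

lemma exists_isReducedWord (w : P.weylGroup) : ∃ l, IsReducedWord b l w := by
  obtain ⟨l, hl⟩ := exists_wordProd_eq b w
  obtain ⟨l', h1, h2⟩ := Nat.sInf_mem (s := {n | ∃ l, wordProd b l = w ∧ l.length = n})
    ⟨_, l, hl, rfl⟩
  exact ⟨l', h1, h2⟩

lemma isReducedWord_reducedWord (w : P.weylGroup) : IsReducedWord b (reducedWord b w) w :=
  Classical.epsilon_spec (exists_isReducedWord b w)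

omit [Finite ι] [P.IsReduced] in
lemma length_wordProd_le (l : List b.support) : length b (wordProd b l) ≤ l.length :=
  Nat.sInf_le ⟨l, rfl, rfl⟩

omit [Finite ι] [P.IsReduced] in
@[simp] lemma length_one : length b 1 = 0 := by
  simpa using length_wordProd_le b []

lemma eq_one_of_length_eq_zero {w : P.weylGroup} (h : length b w = 0) : w = 1 := by
  obtain ⟨l, h1, h2⟩ := exists_isReducedWord b w
  rw [h, List.length_eq_zero_iff] at h2
  simpa [h2] using h1.symm

lemma length_inv (w : P.weylGroup) : length b w⁻¹ = length b w := by
  have key : ∀ w : P.weylGroup, length b w⁻¹ ≤ length b w := fun w ↦ by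
    obtain ⟨l, h1, h2⟩ := exists_isReducedWord b w
    rw [← h2, ← h1, ← wordProd_reverse]
    simpa using length_wordProd_le b l.reverse
  exact (key w).antisymm (by simpa using key w⁻¹)

lemma length_mul_wordProd_le (w : P.weylGroup) (l : List b.support) :
    length b (w * wordProd b l) ≤ length b w + l.length := by
  obtain ⟨l', h1, h2⟩ := exists_isReducedWord b w
  rw [← h2, ← h1, ← wordProd_append]
  simpa using length_wordProd_le b (l' ++ l)

lemma length_mul_simpleRefl_le (w : P.weylGroup) (i : b.support) :
    length b (w * simpleRefl b i) ≤ length b w + 1 := by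
  simpa using length_mul_wordProd_le b w [i]

/-- The exchange condition. -/
lemma exists_wordProd_mul_simpleRefl_eq (l : List b.support) (i : b.support)
    (h : ¬ b.IsPos (wordProd b l • (i : ι))) :
    ∃ l' : List b.support, wordProd b l * simpleRefl b i = wordProd b l' ∧
      l'.length + 1 = l.length := by
  induction l with
  | nil => simp [isPos_support b i] at h
  | cons j l ih =>
    -- If the suffix keeps α_i positive, then it is the letter j that makes it negative; this
    -- happens only to α_j, and then j can be deleted.
    by_cases hl : b.IsPos (wordProd b l • (i : ι))
    · have hj : wordProd b l • (i : ι) = j := by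
        by_contra hne
        apply h
        rw [wordProd_cons, mul_smul]
        exact isPos_simpleRefl_smul hl hne
      refine ⟨l, ?_, rfl⟩
      have := ofIdx_smul_conj (wordProd b l) i
      rw [hj] at this
      rw [wordProd_cons, mul_assoc]
      change simpleRefl b j * _ = _ * simpleRefl b i at this
      rw [← this, ← mul_assoc, simpleRefl_mul_self, one_mul]
    · obtain ⟨l', h1, h2⟩ := ih hl
      exact ⟨j :: l', by rw [wordProd_cons, mul_assoc, h1, wordProd_cons], by simp [h2]⟩

lemma length_mul_simpleRefl_of_not_isPos {w : P.weylGroup} {i : b.support}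
    (h : ¬ b.IsPos (w • (i : ι))) : length b (w * simpleRefl b i) + 1 = length b w := by
  obtain ⟨l, h1, h2⟩ := exists_isReducedWord b w
  obtain ⟨l', h3, h4⟩ := exists_wordProd_mul_simpleRefl_eq b l i (by rwa [h1])
  have h5 := length_wordProd_le b l'
  rw [← h3, h1] at h5
  have h6 := length_mul_simpleRefl_le b (w * simpleRefl b i) i
  rw [mul_simpleRefl_cancel] at h6
  lia

lemma length_mul_simpleRefl_of_isPos {w : P.weylGroup} {i : b.support}
    (h : b.IsPos (w • (i : ι))) : length b (w * simpleRefl b i) = length b w + 1 := by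
  have h1 : ¬ b.IsPos ((w * simpleRefl b i) • (i : ι)) := by
    rwa [isPos_mul_simpleRefl_smul_self, not_not]
  have h2 := length_mul_simpleRefl_of_not_isPos b h1
  rwa [mul_simpleRefl_cancel, eq_comm] at h2

/-- The definition of `Y` compares lengths; later arguments work with signs of roots. -/
lemma length_mul_simpleRefl_lt_iff {w : P.weylGroup} {i : b.support} :
    length b (w * simpleRefl b i) < length b w ↔ ¬ b.IsPos (w • (i : ι)) := by
  by_cases h : b.IsPos (w • (i : ι))
  · have := length_mul_simpleRefl_of_isPos b h
    simp only [h, not_true_eq_false, iff_false]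
    lia
  · have := length_mul_simpleRefl_of_not_isPos b h
    simp only [h, not_false_eq_true, iff_true]
    lia

lemma exists_not_isPos_smul {w : P.weylGroup} (hw : w ≠ 1) :
    ∃ i : b.support, ¬ b.IsPos (w • (i : ι)) := by
  obtain ⟨l, h1, h2⟩ := exists_isReducedWord b w
  rcases l.eq_nil_or_concat' with rfl | ⟨l', i, rfl⟩
  · exact absurd (by simpa using h1.symm) hw
  · refine ⟨i, ?_⟩
    rw [← length_mul_simpleRefl_lt_iff, ← h2, ← h1]
    have := length_wordProd_le b l'
    simp only [wordProd_append, wordProd_cons, wordProd_nil, mul_one, mul_simpleRefl_cancel,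
      List.length_append, List.length_cons, List.length_nil]
    lia

lemma eq_one_of_forall_isPos {w : P.weylGroup} (h : ∀ i : b.support, b.IsPos (w • (i : ι))) :
    w = 1 := by
  by_contra hw
  obtain ⟨i, hi⟩ := exists_not_isPos_smul b hw
  exact hi (h i)

-- An element keeping all simple roots positive is trivial, so W acts faithfully on the finite set
-- of roots.
include b in
lemma finite_weylGroup : Finite P.weylGroup := by
  refine Finite.of_injective (fun (w : P.weylGroup) (k : ι) ↦ w • k) fun w w' h ↦ ?_
  have : w'⁻¹ * w = 1 := eq_one_of_forall_isPos b fun i ↦ by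
    have hi : w • (i : ι) = w' • (i : ι) := congrFun h i
    rw [mul_smul, hi, inv_smul_smul]
    exact isPos_support b i
  rwa [inv_mul_eq_one, eq_comm] at this

end Length

/-! ### The longest element -/

section Longest

variable {ι Λ Λ' : Type*} [AddCommGroup Λ] [AddCommGroup Λ']
  {P : RootDatum ι Λ Λ'} (b : P.Base) [Finite ι] [P.IsReduced]

variable {b} {w₀ : P.weylGroup} (hw₀ : ∀ w, length b w ≤ length b w₀)

include hw₀

/-- No simple reflection lengthens w₀, so w₀ makes every simple root negative; other positive roots
arise by adding simple roots, and heights add. -/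
lemma not_isPos_longest_smul {k : ι} (hk : b.IsPos k) : ¬ b.IsPos (w₀ • k) := by
  refine hk.induction_on_add (p := fun k ↦ ¬ b.IsPos (w₀ • k)) (fun i hi h ↦ ?_)
    fun i j k hk hi hj h ↦ ?_
  · have := length_mul_simpleRefl_of_isPos b (i := ⟨i, hi⟩) h
    have := hw₀ (w₀ * simpleRefl b ⟨i, hi⟩)
    lia
  · have hj' : ¬ b.IsPos (w₀ • j) := fun h ↦ by
      have := length_mul_simpleRefl_of_isPos b (i := ⟨j, hj⟩) h
      have := hw₀ (w₀ * simpleRefl b ⟨j, hj⟩)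
      lia
    have := b.height_add (i := w₀ • i) (j := w₀ • j) (k := w₀ • k)
      (by rw [root_smul, hk, smul_add, root_smul, root_smul])
    rw [b.isPos_iff] at hi hj' h
    lia

lemma isPos_longest_smul_iff {k : ι} : b.IsPos (w₀ • k) ↔ ¬ b.IsPos k := by
  refine ⟨fun h hk ↦ not_isPos_longest_smul hw₀ hk h, fun h ↦ ?_⟩
  let := P.indexNeg
  have hk : b.IsPos (-k) := (RootPairing.Base.IsPos.neg_iff_not b k).2 h
  have h1 := not_isPos_longest_smul hw₀ hk
  refine (isPos_iff_not_of_root_eq_neg (k := w₀ • (-k)) ?_).2 h1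
  rw [root_smul, root_smul, ← smul_neg]
  simp

/-- Left multiplication by w₀ flips the sign of every root, so an ascent of w s_i becomes a descent
of w₀ w s_i. -/
lemma length_longest_mul (w : P.weylGroup) : length b (w₀ * w) + length b w = length b w₀ := by
  induction hn : length b w generalizing w with
  | zero => rw [eq_one_of_length_eq_zero b hn, mul_one, add_zero]
  | succ n ih =>
    obtain ⟨i, hi⟩ := exists_not_isPos_smul b (w := w) (by rintro rfl; simp at hn)
    have h1 := length_mul_simpleRefl_of_not_isPos b hi
    have h2 := ih (w * simpleRefl b i) (by lia)
    have h3 : ¬ b.IsPos ((w₀ * (w * simpleRefl b i)) • (i : ι)) := by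
      rwa [mul_smul, isPos_longest_smul_iff hw₀, isPos_mul_simpleRefl_smul_self, not_not]
    have h4 := length_mul_simpleRefl_of_not_isPos b h3
    rw [← mul_assoc] at h2
    rw [← mul_assoc, mul_simpleRefl_cancel] at h4
    lia

lemma longest_mul_self : w₀ * w₀ = 1 := by
  apply eq_one_of_length_eq_zero b
  have := length_longest_mul hw₀ w₀
  lia

lemma longest_inv : w₀⁻¹ = w₀ := inv_eq_of_mul_eq_one_left (longest_mul_self hw₀)

lemma longest_conj_mul (w w' : P.weylGroup) :
    w₀ * (w * w') * w₀ = (w₀ * w * w₀) * (w₀ * w' * w₀) := by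
  calc w₀ * (w * w') * w₀ = w₀ * w * 1 * w' * w₀ := by group
    _ = _ := by rw [← longest_mul_self hw₀]; group

lemma longest_conj_conj (w : P.weylGroup) : w₀ * (w₀ * w * w₀) * w₀ = w := by
  calc w₀ * (w₀ * w * w₀) * w₀ = (w₀ * w₀) * w * (w₀ * w₀) := by group
    _ = w := by rw [longest_mul_self hw₀, one_mul, mul_one]

lemma length_mul_longest (w : P.weylGroup) : length b (w * w₀) + length b w = length b w₀ := by
  have := length_longest_mul hw₀ w⁻¹
  rwa [length_inv, ← length_inv, mul_inv_rev, inv_inv, longest_inv hw₀] at this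

lemma length_longest_conj (w : P.weylGroup) : length b (w₀ * w * w₀) = length b w := by
  have h1 := length_mul_longest hw₀ (w₀ * w)
  have h2 := length_longest_mul hw₀ w
  lia

/-- The longest element acts on the simple roots by `i ↦ i*`, where `-w₀ αᵢ = α_{i*}`. -/
lemma exists_longest_conj_simpleRefl (i : b.support) :
    ∃ j : b.support, w₀ * simpleRefl b i * w₀ = simpleRefl b j ∧
      P.root j = -(w₀ • P.root i) := by
  have hpos : b.IsPos ((w₀ * simpleRefl b i) • (i : ι)) := by
    rw [mul_smul, isPos_longest_smul_iff hw₀]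
    have := isPos_mul_simpleRefl_smul_self b 1 i
    rw [one_mul, one_smul] at this
    rw [this, not_not]
    exact isPos_support b i
  have hroot : P.root ((w₀ * simpleRefl b i) • (i : ι)) = -(w₀ • P.root i) := by
    rw [mul_smul, root_smul, root_simpleRefl_smul_self, smul_neg]
  have h1 : length b (simpleRefl b i) = 1 := by
    simpa using length_mul_simpleRefl_of_isPos b (w := 1) (i := i)
      (by rw [one_smul]; exact isPos_support b i)
  have h2 := length_longest_conj hw₀ (simpleRefl b i)
  obtain ⟨l, h3, h4⟩ := exists_isReducedWord b (w₀ * simpleRefl b i * w₀)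
  rw [h2, h1, List.length_eq_one_iff] at h4
  obtain ⟨j, rfl⟩ := h4
  rw [wordProd_cons, wordProd_nil, mul_one] at h3
  refine ⟨j, h3.symm, ?_⟩
  -- The root -w₀α_i = w₀s_iα_i is positive, and s_j = w₀s_iw₀ sends it to the negative root w₀α_i.
  -- Only α_j behaves so.
  have hj : (w₀ * simpleRefl b i) • (i : ι) = j := by
    by_contra hne
    have h5 := isPos_simpleRefl_smul hpos hne
    rw [h3, ← mul_smul, mul_assoc, ← mul_assoc w₀ w₀, longest_mul_self hw₀, one_mul, mul_assoc,
      simpleRefl_mul_self, mul_one] at h5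
    exact not_isPos_longest_smul hw₀ (isPos_support b i) h5
  rw [← hj, hroot]

end Longest

/-! ### Alternating words and products -/

section Alternating

variable {α : Type*}

/-- The alternating word `i j i ⋯` with `n` letters. -/
def altWord : α → α → ℕ → List α
  | _, _, 0 => []
  | i, j, n + 1 => i :: altWord j i n

/-- The letter in position `n` (counted from `0`) of the word `i j i ⋯`. -/
def altLetter : α → α → ℕ → α
  | i, _, 0 => i
  | i, j, n + 1 => altLetter j i n

@[simp] lemma length_altWord (i j : α) (n : ℕ) : (altWord i j n).length = n := by
  induction n generalizing i j with
  | zero => rfl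
  | succ n ih => simp [altWord, ih]

lemma altWord_succ (i j : α) (n : ℕ) : altWord i j (n + 1) = altWord i j n ++ [altLetter i j n] := by
  induction n generalizing i j with
  | zero => rfl
  | succ n ih => rw [altWord, ih, altWord, altLetter, List.cons_append]

lemma altLetter_eq (i j : α) (n : ℕ) : altLetter i j n = if Even n then i else j := by
  induction n generalizing i j with
  | zero => simp [altLetter]
  | succ n ih => simp only [altLetter, ih, Nat.even_add_one]; split_ifs <;> simp_all

lemma reverse_altWord (i j : α) (n : ℕ) :
    (altWord i j n).reverse = if Even n then altWord j i n else altWord i j n := by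
  induction n with
  | zero => simp [altWord]
  | succ n ih =>
    conv_lhs => rw [altWord_succ, List.reverse_append, ih, altLetter_eq]
    simp only [Nat.even_add_one]
    split_ifs <;> simp_all [altWord]

lemma prod_map_altWord {M : Type*} [Monoid M] (f : α → M) (i j : α) (n : ℕ) :
    ((altWord i j n).map f).prod = altProd (f i) (f j) n := by
  induction n generalizing i j with
  | zero => rfl
  | succ n ih => simp [altWord, altProd, ih]

lemma map_altProd {M N F : Type*} [Monoid M] [Monoid N] [FunLike F M N] [MonoidHomClass F M N]
    (f : F) (x y : M) (n : ℕ) : f (altProd x y n) = altProd (f x) (f y) n := by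
  induction n generalizing x y with
  | zero => simp [altProd]
  | succ n ih => simp [altProd, ih]

/-- Hence the two alternating products agree at the order of xy, and at no smaller positive length.
-/
lemma altProd_mul_inv {G : Type*} [Group G] {x y : G} (hx : x * x = 1) (hy : y * y = 1) (n : ℕ) :
    altProd x y n * (altProd y x n)⁻¹ = (x * y) ^ n := by
  induction n generalizing x y with
  | zero => simp [altProd]
  | succ n ih =>
    have h1 : SemiconjBy x (y * x) (x * y) := by simp [SemiconjBy, mul_assoc]
    have h2 := (h1.pow_right n).eq
    rw [pow_succ, ← mul_assoc, ← h2, ← ih hy hx, altProd, altProd, mul_inv_rev,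
      inv_eq_of_mul_eq_one_left hy]
    simp only [mul_assoc]

end Alternating

/-! ### Dihedral subgroups and Matsumoto's theorem -/

section Dihedral

variable {ι Λ Λ' : Type*} [AddCommGroup Λ] [AddCommGroup Λ']
  {P : RootDatum ι Λ Λ'} (b : P.Base)

variable {b} in
lemma height_eq_of_root_eq {i j k : ι} {x y : ℤ}
    (hk : P.root k = x • P.root i + y • P.root j) :
    b.height k = x * b.height i + y * b.height j := by
  obtain ⟨f, -, -, hf⟩ := b.exists_root_eq_sum_int i
  obtain ⟨g, -, -, hg⟩ := b.exists_root_eq_sum_int j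
  have hfg : P.root k = ∑ l ∈ b.support, (x • f + y • g) l • P.root l := by
    simp_rw [Pi.add_apply, Pi.smul_apply, add_smul, smul_assoc, Finset.sum_add_distrib,
      ← Finset.smul_sum, ← hf, ← hg, hk]
  simp_rw [RootPairing.Base.height_eq_sum hf, RootPairing.Base.height_eq_sum hg,
    RootPairing.Base.height_eq_sum hfg, Pi.add_apply, Pi.smul_apply, smul_eq_mul,
    Finset.sum_add_distrib, Finset.mul_sum]

-- Coordinates of a root in a base share one sign, and height x + y > 0 excludes the negative one.
variable {b} in
lemma nonneg_of_isPos_of_root_eq {k : ι} (hk : b.IsPos k) {i j : b.support} (hij : i ≠ j) {x y : ℤ}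
    (h : P.root k = x • P.root i + y • P.root j) : 0 ≤ x ∧ 0 ≤ y := by
  classical
  have hij' : (i : ι) ≠ j := fun h ↦ hij (Subtype.ext h)
  let f : ι → ℤ := Pi.single (i : ι) x + Pi.single (j : ι) y
  have hfi : f i = x := by simp [f, hij']
  have hfj : f j = y := by simp [f, hij'.symm]
  have hsum : ∑ l ∈ b.support, f l • P.root l = x • P.root i + y • P.root j := by
    simp only [f, Pi.add_apply, add_smul, Finset.sum_add_distrib]
    congr 1
    · rw [Finset.sum_eq_single_of_mem (i : ι) i.2 (by simp_all)]; simp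
    · rw [Finset.sum_eq_single_of_mem (j : ι) j.2 (by simp_all)]; simp
  rcases b.pos_or_neg_of_sum_smul_root_mem f ⟨k, by rw [hsum, h]⟩ (fun l hl ↦ by
    by_contra hl'
    apply hl
    have h1 : l ≠ i := by rintro rfl; exact hl' i.2
    have h2 : l ≠ j := by rintro rfl; exact hl' j.2
    simp [f, h1, h2]) with hf | hf
  · exact ⟨hfi ▸ hf.le i, hfj ▸ hf.le j⟩
  · have h1 : x ≤ 0 := hfi ▸ hf.le i
    have h2 : y ≤ 0 := hfj ▸ hf.le j
    have h3 := height_eq_of_root_eq (b := b) h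
    rw [RootPairing.Base.height_one_of_mem_support i.2,
      RootPairing.Base.height_one_of_mem_support j.2] at h3
    rw [b.isPos_iff] at hk
    lia

lemma exists_root_altProd_smul_eq (i j : b.support) (n : ℕ) :
    ∃ x y : ℤ, P.root (altProd (simpleRefl b i) (simpleRefl b j) n • ((altLetter i j n : b.support) : ι)) =
      x • P.root i + y • P.root j := by
  induction n generalizing i j with
  | zero => exact ⟨1, 0, by simp [altProd, altLetter]⟩
  | succ n ih =>
    obtain ⟨x, y, h⟩ := ih j i
    refine ⟨-y - P.pairing j i * x, x, ?_⟩
    rw [altProd, altLetter, mul_smul, root_smul, h, smul_add, smul_comm _ x, smul_comm _ y,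
      simpleRefl, ofIdx_smul_root, ofIdx_smul_root, P.pairing_same]
    module

lemma altProd_simpleRefl_comm (i j : b.support) :
    altProd (simpleRefl b i) (simpleRefl b j) (orderOf (simpleRefl b i * simpleRefl b j)) =
      altProd (simpleRefl b j) (simpleRefl b i) (orderOf (simpleRefl b i * simpleRefl b j)) := by
  rw [← mul_inv_eq_one, altProd_mul_inv (simpleRefl_mul_self b i) (simpleRefl_mul_self b j),
    pow_orderOf_eq_one]

lemma wordProd_altWord (i j : b.support) (n : ℕ) :
    wordProd b (altWord i j n) = altProd (simpleRefl b i) (simpleRefl b j) n :=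
  prod_map_altWord _ _ _ _

lemma altProd_simpleRefl_succ (i j : b.support) (n : ℕ) :
    altProd (simpleRefl b i) (simpleRefl b j) (n + 1) =
      altProd (simpleRefl b i) (simpleRefl b j) n * simpleRefl b (altLetter i j n) := by
  simp [← wordProd_altWord, altWord_succ]

lemma orderOf_simpleRefl_comm (i j : b.support) :
    orderOf (simpleRefl b i * simpleRefl b j) = orderOf (simpleRefl b j * simpleRefl b i) := by
  rw [← orderOf_inv, mul_inv_rev, simpleRefl_inv, simpleRefl_inv]

variable [Finite ι] [P.IsReduced]

/-- The preceding root is positive, so s_i can make it negative only if it is α_i. Then the two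
alternating products of length n + 1 coincide, which gives (s_i s_j)^(n+1) = 1 below the order. -/
lemma isPos_altProd_smul {i j : b.support} {n : ℕ}
    (hn : n < orderOf (simpleRefl b i * simpleRefl b j)) :
    b.IsPos (altProd (simpleRefl b i) (simpleRefl b j) n • ((altLetter i j n : b.support) : ι)) := by
  induction n generalizing i j with
  | zero =>
    rw [altProd, altLetter, one_smul]
    exact isPos_support b i
  | succ n ih =>
    have h1 := ih (i := j) (j := i) (by rw [orderOf_simpleRefl_comm]; lia)
    rw [altProd, altLetter, mul_smul]
    refine isPos_simpleRefl_smul h1 fun h2 ↦ ?_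
    have h3 := ofIdx_smul_conj (altProd (simpleRefl b j) (simpleRefl b i) n) ((altLetter j i n : b.support) : ι)
    rw [h2] at h3
    change simpleRefl b i * _ = _ * simpleRefl b (altLetter j i n) at h3
    rw [← altProd_simpleRefl_succ] at h3
    have h5 : altProd (simpleRefl b i) (simpleRefl b j) (n + 1) =
      altProd (simpleRefl b j) (simpleRefl b i) (n + 1) := h3
    rw [← mul_inv_eq_one, altProd_mul_inv (simpleRefl_mul_self b i) (simpleRefl_mul_self b j)] at h5
    exact hn.not_ge (orderOf_le_of_pow_eq_one (Nat.succ_pos n) h5)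

/-- If `i` and `j` are right descents of `w`, then so is the longest element of the dihedral
group generated by `s_i` and `s_j`. -/
lemma length_mul_altProd {w : P.weylGroup} {i j : b.support} (hij : i ≠ j)
    (hi : ¬ b.IsPos (w • (i : ι))) (hj : ¬ b.IsPos (w • (j : ι))) {n : ℕ}
    (hn : n ≤ orderOf (simpleRefl b i * simpleRefl b j)) :
    length b (w * altProd (simpleRefl b i) (simpleRefl b j) n) + n = length b w := by
  induction n with
  | zero => simp [altProd]
  | succ n ih =>
    have h1 := ih (by lia)
    have h3 : ¬ b.IsPos ((w * altProd (simpleRefl b i) (simpleRefl b j) n) •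
        ((altLetter i j n : b.support) : ι)) := by
      obtain ⟨x, y, hxy⟩ := exists_root_altProd_smul_eq b i j n
      obtain ⟨hx, hy⟩ := nonneg_of_isPos_of_root_eq (isPos_altProd_smul b (by lia)) hij hxy
      rw [mul_smul]
      set k := altProd (simpleRefl b i) (simpleRefl b j) n • ((altLetter i j n : b.support) : ι)
      have h4 : P.root (w • k) = x • P.root (w • (i : ι)) + y • P.root (w • (j : ι)) := by
        rw [root_smul, hxy, smul_add, smul_comm w x, smul_comm w y, root_smul, root_smul]
      rw [b.isPos_iff] at hi hj ⊢
      rw [height_eq_of_root_eq h4]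
      push Not at hi hj ⊢
      nlinarith
    have h4 := length_mul_simpleRefl_of_not_isPos b h3
    rw [mul_assoc, ← altProd_simpleRefl_succ] at h4
    lia

lemma length_altProd (i j : b.support) {n : ℕ}
    (hn : n ≤ orderOf (simpleRefl b i * simpleRefl b j)) :
    length b (altProd (simpleRefl b i) (simpleRefl b j) n) = n := by
  induction n with
  | zero => simp [altProd]
  | succ n ih =>
    have h := length_mul_simpleRefl_of_isPos b (isPos_altProd_smul b (i := i) (j := j) (n := n) hn)
    rw [altProd_simpleRefl_succ, h, ih (by lia)]

lemma isReducedWord_altWord (i j : b.support) {n : ℕ}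
    (hn : n ≤ orderOf (simpleRefl b i * simpleRefl b j)) :
    IsReducedWord b (altWord i j n) (altProd (simpleRefl b i) (simpleRefl b j) n) :=
  ⟨wordProd_altWord b i j n, by rw [length_altWord, length_altProd b i j hn]⟩

lemma orderOf_simpleRefl_mul_pos (i j : b.support) :
    0 < orderOf (simpleRefl b i * simpleRefl b j) := by
  have := finite_weylGroup b
  exact orderOf_pos _

lemma length_append_singleton_of_isReducedWord {l : List b.support} {i : b.support}
    {w : P.weylGroup} (h : IsReducedWord b (l ++ [i]) w) :
    IsReducedWord b l (w * simpleRefl b i) ∧ ¬ b.IsPos (w • (i : ι)) := by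
  obtain ⟨h1, h2⟩ := h
  have h3 : wordProd b l = w * simpleRefl b i := by simp [← h1]
  have h4 := length_wordProd_le b l
  rw [h3] at h4
  rw [List.length_append, List.length_singleton] at h2
  have h5 : ¬ b.IsPos (w • (i : ι)) := by
    rw [← length_mul_simpleRefl_lt_iff]
    lia
  exact ⟨⟨h3, by have := length_mul_simpleRefl_of_not_isPos b h5; lia⟩, h5⟩

/-- **Matsumoto's theorem**. -/
theorem prod_map_eq_of_isReducedWord {M : Type*} [Monoid M] (f : b.support → M)
    (hf : ∀ i j, i ≠ j → altProd (f i) (f j) (orderOf (simpleRefl b i * simpleRefl b j)) =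
      altProd (f j) (f i) (orderOf (simpleRefl b i * simpleRefl b j)))
    {w : P.weylGroup} {l l' : List b.support} (hl : IsReducedWord b l w)
    (hl' : IsReducedWord b l' w) : (l.map f).prod = (l'.map f).prod := by
  induction hn : length b w generalizing w l l' with
  | zero =>
    have h1 := hl.2
    have h2 := hl'.2
    rw [hn, List.length_eq_zero_iff] at h1 h2
    rw [h1, h2]
  | succ n ih =>
    rcases l.eq_nil_or_concat' with rfl | ⟨l₁, i, rfl⟩
    · have := hl.2; simp_all
    rcases l'.eq_nil_or_concat' with rfl | ⟨l₂, j, rfl⟩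
    · have := hl'.2; simp_all
    obtain ⟨h1, hi⟩ := length_append_singleton_of_isReducedWord b hl
    obtain ⟨h2, hj⟩ := length_append_singleton_of_isReducedWord b hl'
    have hi' := length_mul_simpleRefl_of_not_isPos b hi
    have hj' := length_mul_simpleRefl_of_not_isPos b hj
    by_cases hij : i = j
    · subst hij
      rw [List.map_append, List.prod_append, List.map_append, List.prod_append,
        ih h1 h2 (by lia)]
    obtain ⟨m, hm⟩ : ∃ m, orderOf (simpleRefl b i * simpleRefl b j) = m + 1 :=
      Nat.exists_eq_succ_of_ne_zero (orderOf_simpleRefl_mul_pos b i j).ne'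
    set u := w * altProd (simpleRefl b i) (simpleRefl b j) (m + 1) with hu
    obtain ⟨a, ha⟩ := exists_isReducedWord b u
    -- Here w = u·(longest dihedral element) with lengths adding. By induction, a reduced word of w
    -- ending in i' can be traded for a fixed word of u followed by the alternating word ending in
    -- i'; the two resulting words differ by one braid relation.
    have key : ∀ {i' j' : b.support} {l₃ : List b.support},
        u = w * altProd (simpleRefl b i') (simpleRefl b j') (m + 1) →
        length b u + (m + 1) = length b w →
        length b (w * simpleRefl b i') + 1 = length b w →
        IsReducedWord b l₃ (w * simpleRefl b i') →
        ((l₃ ++ [i']).map f).prod = (a.map f).prod * ((altWord i' j' (m + 1)).reverse.map f).prod := by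
      intro i' j' l₃ h3 h4 h5 h6
      have h7 : IsReducedWord b (a ++ (altWord j' i' m).reverse) (w * simpleRefl b i') := by
        constructor
        · rw [wordProd_append, ha.1, h3, wordProd_reverse, wordProd_altWord, altProd]
          group
        · have := ha.2
          simp only [List.length_append, List.length_reverse, length_altWord]
          lia
      rw [List.map_append, List.prod_append, ih h6 h7 (by lia), altWord]
      simp [mul_assoc]
    have hum := length_mul_altProd b hij hi hj (n := m + 1) hm.ge
    have hcomm := altProd_simpleRefl_comm b i j
    rw [hm] at hcomm
    rw [key (j' := j) hu hum hi' h1, key (j' := i) (by rw [hu, hcomm]) hum hj' h2]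
    congr 1
    have hfij := hf i j hij
    rw [hm] at hfij
    rw [reverse_altWord, reverse_altWord]
    split_ifs
    · rw [prod_map_altWord, prod_map_altWord, hfij]
    · rw [prod_map_altWord, prod_map_altWord, hfij]

end Dihedral

/-! ### The coefficient ring and the functional equation of the shifts -/

section CoefficientRing

variable {Λ : Type*} [AddCommGroup Λ] [Module.Free ℤ Λ]

lemma expo_injective : Function.Injective (expo : Λ → FracGroupRing Λ) := by
  intro l l' h
  have h1 := IsFractionRing.injective (AddMonoidAlgebra ℤ Λ) (FracGroupRing Λ) h
  exact AddMonoidAlgebra.single_left_injective one_ne_zero h1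

lemma expo_zero : expo (0 : Λ) = 1 :=
  map_one (algebraMap (AddMonoidAlgebra ℤ Λ) (FracGroupRing Λ))

lemma expo_add (l l' : Λ) : expo (l + l') = expo l * expo l' := by
  rw [expo, expo, expo, ← map_mul, AddMonoidAlgebra.single_mul_single, one_mul]

lemma E_ne_zero {l : Λ} (hl : l ≠ 0) : E l ≠ 0 := by
  rw [E, sub_ne_zero, ← expo_zero]
  exact fun h ↦ hl (neg_eq_zero.1 (expo_injective h))

lemma fracAct_expo (φ : Λ ≃+ Λ) (l : Λ) : fracAct φ (expo l) = expo (φ l) := by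
  rw [fracAct, expo]
  erw [IsFractionRing.ringEquivOfRingEquiv_algebraMap]
  rw [expo]
  congr 1
  exact AddMonoidAlgebra.domCongr_single (R := ℤ) (A := ℤ) φ l 1

lemma fracAct_E (φ : Λ ≃+ Λ) (l : Λ) : fracAct φ (E l) = E (φ l) := by
  rw [E, map_sub, fracAct_expo, map_one, map_neg, E]

lemma fracAct_fracAct (φ ψ : Λ ≃+ Λ) (x : FracGroupRing Λ) :
    fracAct φ (fracAct ψ x) = fracAct (ψ.trans φ) x := by
  have : (fracAct φ).toRingHom.comp (fracAct ψ).toRingHom = (fracAct (ψ.trans φ)).toRingHom := by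
    apply IsLocalization.ringHom_ext (nonZeroDivisors (AddMonoidAlgebra ℤ Λ))
    apply AddMonoidAlgebra.ringHom_ext
    · intro n
      exact congr($(RingHom.ext_int
        ((((fracAct φ).toRingHom.comp (fracAct ψ).toRingHom).comp
          (algebraMap (AddMonoidAlgebra ℤ Λ) (FracGroupRing Λ))).comp
            AddMonoidAlgebra.singleZeroRingHom)
        (((fracAct (ψ.trans φ)).toRingHom.comp
          (algebraMap (AddMonoidAlgebra ℤ Λ) (FracGroupRing Λ))).comp
            AddMonoidAlgebra.singleZeroRingHom)) n)
    · intro l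
      change fracAct φ (fracAct ψ (expo l)) = fracAct (ψ.trans φ) (expo l)
      rw [fracAct_expo, fracAct_expo, fracAct_expo]
      rfl
  exact congr($this x)

/-- The inclusion of the quotient field of the group ring in `Q_{t₁,t₂}(Λ)`. -/
def ofFrac (Λ : Type*) [AddCommGroup Λ] [Module.Free ℤ Λ] : FracGroupRing Λ →+* CoeffRing Λ :=
  (Algebra.TensorProduct.includeRight : FracGroupRing Λ →ₐ[ℤ] ParamRing ⊗[ℤ] FracGroupRing Λ).toRingHom

lemma shift_eq (l : Λ) :
    shift l = algebraMap ParamRing (CoeffRing Λ) (t₁ + t₂) * ofFrac Λ (E l)⁻¹ := by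
  have h : ((t₁ + t₂) ⊗ₜ[ℤ] 1 : ParamRing ⊗[ℤ] FracGroupRing Λ) * (1 ⊗ₜ[ℤ] (E l)⁻¹) =
      (t₁ + t₂) ⊗ₜ[ℤ] (E l)⁻¹ := by
    rw [Algebra.TensorProduct.tmul_mul_tmul, mul_one, one_mul]
  exact h.symm

lemma coeffAct_ofFrac (φ : Λ ≃+ Λ) (x : FracGroupRing Λ) :
    coeffAct φ (ofFrac Λ x) = ofFrac Λ (fracAct φ x) := by
  change Algebra.TensorProduct.map (AlgHom.id ParamRing ParamRing)
    (fracAct φ).toRingHom.toIntAlgHom ((1 : ParamRing) ⊗ₜ[ℤ] x) = 1 ⊗ₜ[ℤ] (fracAct φ x)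
  rw [Algebra.TensorProduct.map_tmul, map_one]
  rfl

lemma coeffRing_algHom_ext {S : Type*} [Semiring S] [Algebra ParamRing S]
    {f g : CoeffRing Λ →ₐ[ParamRing] S} (h : ∀ x, f (ofFrac Λ x) = g (ofFrac Λ x)) : f = g := by
  refine AlgHom.ext fun x ↦ ?_
  refine TensorProduct.induction_on (motive := fun x : CoeffRing Λ ↦ f x = g x) x ?_ ?_ ?_
  · exact (map_zero f).trans (map_zero g).symm
  · intro r x
    have : (r ⊗ₜ[ℤ] x : ParamRing ⊗[ℤ] FracGroupRing Λ) =
        (r • (1 ⊗ₜ[ℤ] x : ParamRing ⊗[ℤ] FracGroupRing Λ)) := by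
      rw [TensorProduct.smul_tmul', smul_eq_mul, mul_one]
    rw [this]
    exact (map_smul f r _).trans ((congrArg (r • ·) (h x)).trans (map_smul g r _).symm)
  · intro x y hx hy
    exact (map_add f x y).trans ((congrArg₂ (· + ·) hx hy).trans (map_add g x y).symm)

lemma coeffAct_coeffAct (φ ψ : Λ ≃+ Λ) (x : CoeffRing Λ) :
    coeffAct φ (coeffAct ψ x) = coeffAct (ψ.trans φ) x := by
  have : (coeffAct φ).comp (coeffAct ψ) = coeffAct (ψ.trans φ) :=
    coeffRing_algHom_ext fun x ↦ by
      rw [AlgHom.comp_apply, coeffAct_ofFrac, coeffAct_ofFrac, coeffAct_ofFrac, fracAct_fracAct]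
  exact congr($this x)

lemma coeffAct_shift (φ : Λ ≃+ Λ) (l : Λ) : coeffAct φ (shift l) = shift (φ l) := by
  rw [shift_eq, map_mul, AlgHom.commutes, coeffAct_ofFrac, map_inv₀, fracAct_E, shift_eq]

lemma star_shift (l : Λ) : star Λ (shift l) = shift (-l) := coeffAct_shift _ l

/-- The ring is a polynomial ring in t₁, t₂ over the field Q(ℤ[Λ]). Dedekind independence and the
determinant argument both rely on this. -/
instance : IsDomain (CoeffRing Λ) :=
  ((Algebra.TensorProduct.comm ℤ ParamRing (FracGroupRing Λ)).toRingEquiv.trans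
    (MvPolynomial.algebraTensorAlgEquiv (σ := Fin 2) ℤ (FracGroupRing Λ)).toRingEquiv).toMulEquiv.isDomain
    (MvPolynomial (Fin 2) (FracGroupRing Λ))

lemma ofFrac_injective : Function.Injective (ofFrac Λ) := (ofFrac Λ).injective

/-- The functional equation behind Yang–Baxter. It comes from multiplicativity of the exponential,
E(l+l') + 1 = (E(l)+1)(E(l')+1). -/
lemma shift_mul_shift {l l' : Λ} (hl : l ≠ 0) (hl' : l' ≠ 0) (h : l + l' ≠ 0) :
    shift l * shift l' = shift (l + l') *
      (shift l + shift l' + algebraMap ParamRing (CoeffRing Λ) (t₁ + t₂)) := by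
  have key : (E l)⁻¹ * (E l')⁻¹ = (E (l + l'))⁻¹ * ((E l)⁻¹ + (E l')⁻¹ + 1) := by
    have h1 := E_ne_zero hl
    have h2 := E_ne_zero hl'
    have h3 := E_ne_zero h
    have h4 : E (l + l') = (E l + 1) * (E l' + 1) - 1 := by
      simp only [E, neg_add, expo_add]; ring
    field_simp
    rw [h4]
    ring
  have h5 := congr(ofFrac Λ $key)
  simp only [map_mul, map_add, map_one] at h5
  simp only [shift_eq]
  linear_combination (algebraMap ParamRing (CoeffRing Λ) (t₁ + t₂)) ^ 2 * h5

lemma shift_neg {l : Λ} (hl : l ≠ 0) :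
    shift (-l) = -shift l - algebraMap ParamRing (CoeffRing Λ) (t₁ + t₂) := by
  have key : (E (-l))⁻¹ = -(E l)⁻¹ - 1 := by
    have h1 := E_ne_zero hl
    have h2 := E_ne_zero (neg_ne_zero.2 hl)
    have h3 : expo l * expo (-l) = 1 := by rw [← expo_add, add_neg_cancel, expo_zero]
    have h4 : expo l = E (-l) + 1 := by simp [E]
    have h5 : expo (-l) = E l + 1 := by simp [E]
    rw [h4, h5] at h3
    field_simp
    linear_combination h3
  rw [shift_eq, shift_eq, key, map_sub, map_neg, map_one]
  ring

lemma shift_add_ne_zero {l : Λ} (hl : l ≠ 0) :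
    shift l + algebraMap ParamRing (CoeffRing Λ) t₁ ≠ 0 := by
  intro h
  -- Specialising t₁ = 0, t₂ = 1 leaves 1/E(l), which is nonzero.
  let f : ParamRing ⊗[ℤ] FracGroupRing Λ →ₐ[ℤ] FracGroupRing Λ :=
    Algebra.TensorProduct.productMap (MvPolynomial.aeval ![0, 1]) (AlgHom.id ℤ _)
  have h1 : f ((t₁ + t₂) ⊗ₜ[ℤ] (E l)⁻¹ + t₁ ⊗ₜ[ℤ] 1) = 0 := (congrArg f h).trans (map_zero f)
  rw [map_add, Algebra.TensorProduct.productMap_apply_tmul,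
    Algebra.TensorProduct.productMap_apply_tmul, map_add, t₁, t₂, MvPolynomial.aeval_X,
    MvPolynomial.aeval_X] at h1
  simp [E_ne_zero hl] at h1

end CoefficientRing

/-! ### Weyl group action on the coefficients -/

section WeylAction

variable {ι Λ Λ' : Type*} [AddCommGroup Λ] [Module.Free ℤ Λ] [AddCommGroup Λ']
  {P : RootDatum ι Λ Λ'}

lemma weylAct_shift (w : P.weylGroup) (l : Λ) : weylAct w (shift l) = shift (w • l) :=
  coeffAct_shift _ l

lemma weylAct_weylAct (w w' : P.weylGroup) (x : CoeffRing Λ) :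
    weylAct w (weylAct w' x) = weylAct (w * w') x := by
  rw [weylAct, weylAct, coeffAct_coeffAct, weylAct]
  have h : (DistribMulAction.toAddEquiv Λ w').trans (DistribMulAction.toAddEquiv Λ w) =
      DistribMulAction.toAddEquiv Λ (w * w') := by
    ext l
    exact (mul_smul w w' l).symm
  rw [h]

@[simp]
lemma weylAct_one (x : CoeffRing Λ) : weylAct (1 : P.weylGroup) x = x := by
  have : weylAct (1 : P.weylGroup) = AlgHom.id ParamRing (CoeffRing Λ) :=
    coeffRing_algHom_ext fun x ↦ by
      rw [weylAct, coeffAct_ofFrac, AlgHom.id_apply]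
      congr 1
      -- The map is idempotent and injective, hence the identity.
      have h := fracAct_fracAct (DistribMulAction.toAddEquiv Λ (1 : P.weylGroup))
        (DistribMulAction.toAddEquiv Λ (1 : P.weylGroup)) x
      have h2 : (DistribMulAction.toAddEquiv Λ (1 : P.weylGroup)).trans
          (DistribMulAction.toAddEquiv Λ (1 : P.weylGroup)) =
          (DistribMulAction.toAddEquiv Λ (1 : P.weylGroup)) := by
        ext l; simp
      rw [h2] at h
      exact (fracAct _).injective h
  exact congr($this x)

lemma weylAct_injective :
    Function.Injective (weylAct : P.weylGroup → CoeffRing Λ →ₐ[ParamRing] CoeffRing Λ) := by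
  intro w w' h
  refine eq_of_smul_eq fun l ↦ ?_
  have h1 : weylAct w (ofFrac Λ (expo l)) = weylAct w' (ofFrac Λ (expo l)) := by rw [h]
  rw [weylAct, weylAct, coeffAct_ofFrac, coeffAct_ofFrac, fracAct_expo, fracAct_expo] at h1
  exact expo_injective (ofFrac_injective h1)

end WeylAction

/-! ### Yang–Baxter identities for two generators, from quadratic relations alone -/

section RankTwo

variable {K A : Type*} [CommRing K] [Ring A] [Algebra K A] {p q : K} {x y : A}

lemma mul_mul_of_quadratic (hx : x * x = p • x - q • 1) (z : A) :
    x * (x * z) = p • (x * z) - q • z := by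
  rw [← mul_assoc, hx, sub_mul, smul_mul_assoc, smul_mul_assoc, one_mul]

lemma yangBaxter_two (c₁ c₂ : K) :
    (x + algebraMap K A c₁) * (y + algebraMap K A c₂) -
      (y + algebraMap K A c₂) * (x + algebraMap K A c₁) = x * y - y * x := by
  simp only [Algebra.algebraMap_eq_smul_one, mul_add, add_mul, smul_mul_assoc, mul_smul_comm,
    one_mul, mul_one]
  module

/-- Type A₂. The cₖ are the shifts of the positive roots in the order met by the word, and `h` is
the functional equation for the middle root. No braid relation is assumed, so the braid words
survive on the right. -/
lemma yangBaxter_three (hx : x * x = p • x - q • 1) (hy : y * y = p • y - q • 1) {c₁ c₂ c₃ : K}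
    (h : c₁ * c₃ = c₂ * (c₁ + c₃ + p)) :
    (x + algebraMap K A c₁) * (y + algebraMap K A c₂) * (x + algebraMap K A c₃) -
      (y + algebraMap K A c₃) * (x + algebraMap K A c₂) * (y + algebraMap K A c₁) =
      x * (y * x) - y * (x * y) := by
  simp only [Algebra.algebraMap_eq_smul_one, mul_add, add_mul, smul_mul_assoc, mul_smul_comm,
    one_mul, mul_one, hx, hy, mul_assoc, smul_add, smul_sub]
  match_scalars
  all_goals first
    | ring1
    | linear_combination h
    | linear_combination -h

lemma yangBaxter_four (hx : x * x = p • x - q • 1) (hy : y * y = p • y - q • 1) {c₁ c₂ c₃ c₄ : K}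
    (h₁ : c₁ * c₃ = c₂ * (c₁ + c₃ + p)) (h₂ : c₁ * c₄ = c₃ * (c₁ + c₄ + p)) :
    (x + algebraMap K A c₁) * (y + algebraMap K A c₂) * (x + algebraMap K A c₃) *
        (y + algebraMap K A c₄) -
      (y + algebraMap K A c₄) * (x + algebraMap K A c₃) * (y + algebraMap K A c₂) *
        (x + algebraMap K A c₁) =
      x * (y * (x * y)) - y * (x * (y * x)) := by
  simp only [Algebra.algebraMap_eq_smul_one, mul_add, add_mul, smul_mul_assoc, mul_smul_comm,
    one_mul, mul_one, hx, hy, mul_assoc, smul_add, smul_sub, mul_sub, sub_mul]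
  match_scalars
  all_goals first
    | ring1
    | linear_combination h₁ + h₂
    | linear_combination -h₁ - h₂

/-- Normal form of `(x + c₁) (y + c₂) (x + c₃)`. -/
lemma yangBaxter_three_expand (hx : x * x = p • x - q • 1) (c₁ c₂ c₃ : K) :
    (x + algebraMap K A c₁) * (y + algebraMap K A c₂) * (x + algebraMap K A c₃) =
      x * (y * x) + c₁ • (y * x) + c₃ • (x * y) + (c₁ * c₃) • y +
        (c₂ * (c₁ + c₃ + p)) • x + (c₁ * c₂ * c₃ - c₂ * q) • 1 := by
  simp only [Algebra.algebraMap_eq_smul_one, mul_add, add_mul, smul_mul_assoc, mul_smul_comm,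
    one_mul, mul_one, hx, mul_assoc, smul_add, smul_sub]
  module

lemma yangBaxter_six (hx : x * x = p • x - q • 1) (hy : y * y = p • y - q • 1)
    {c₁ c₂ c₃ c₄ c₅ c₆ : K}
    (h₁ : c₁ * c₃ = c₂ * (c₁ + c₃ + p)) (h₂ : c₁ * c₆ = c₅ * (c₁ + c₆ + p))
    (h₃ : c₃ * c₅ = c₄ * (c₃ + c₅ + p)) (h₄ : c₁ * c₅ = c₃ * (c₁ + c₅ + p))
    (h₅ : c₂ * c₆ = c₄ * (c₂ + c₆ + p)) :
    (x + algebraMap K A c₁) * (y + algebraMap K A c₂) * (x + algebraMap K A c₃) *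
        (y + algebraMap K A c₄) * (x + algebraMap K A c₅) * (y + algebraMap K A c₆) -
      (y + algebraMap K A c₆) * (x + algebraMap K A c₅) * (y + algebraMap K A c₄) *
        (x + algebraMap K A c₃) * (y + algebraMap K A c₂) * (x + algebraMap K A c₁) =
      x * (y * (x * (y * (x * y)))) - y * (x * (y * (x * (y * x)))) := by
  have hx' := mul_mul_of_quadratic hx
  have hy' := mul_mul_of_quadratic hy
  -- Giving x, y, cₖ, p degree one and q degree two makes everything homogeneous. Up to sign, `key₁`
  -- is the discrepancy at words of length four and `key₂` the one at words of length two; both lie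
  -- in the ideal generated by the five functional equations.
  have key₁ : c₁ * c₂ - c₁ * c₆ + c₂ * c₃ + c₂ * p + c₃ * c₄ + c₃ * p + c₄ * c₅ + c₄ * p +
      c₅ * c₆ + c₅ * p = 0 := by
    linear_combination -h₁ - h₂ - h₃ - h₄
  have key₂ : c₁*c₂*c₃*c₄ - c₁*c₂*c₃*c₆ + c₁*c₂*c₄*c₅ + c₁*c₂*c₄*p + c₁*c₂*c₅*c₆ + c₁*c₂*c₅*p -
      c₁*c₃*c₄*c₆ - c₁*c₃*c₆*p - c₁*c₃*q - c₁*c₄*c₅*c₆ - c₁*c₄*c₆*p + c₁*c₅*q + c₂*c₃*c₄*c₅ +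
      c₂*c₃*c₄*p + c₂*c₃*c₅*c₆ + c₂*c₃*c₅*p + c₂*c₄*c₅*p + c₂*c₄*p*p - c₂*c₄*q + c₂*c₅*c₆*p +
      c₂*c₅*p*p + c₂*c₆*q + c₃*c₄*c₅*c₆ + c₃*c₄*c₅*p + c₃*c₅*c₆*p + c₃*c₅*p*p - c₃*c₅*q -
      c₃*p*q - c₄*c₆*q - c₄*p*q = 0 := by
    linear_combination (-c₃*c₄ + c₃*c₅ - 2*c₄*c₅ + c₄*c₆ - c₄*p - c₅*c₆ - c₅*p) * h₁ +
      (-c₂*c₃ + c₂*c₄ - c₃*c₄ - c₃*p) * h₂ + (-c₁*c₃ + c₁*c₆ + c₂*c₃ - c₂*c₆) * h₃ +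
      q * h₄ + q * h₅
  -- Each product of six factors is expanded as two blocks of three.
  have e₁ := yangBaxter_three_expand (A := A) (y := y) hx c₁ c₂ c₃
  have e₂ := yangBaxter_three_expand (A := A) (y := x) hy c₄ c₅ c₆
  have e₃ := yangBaxter_three_expand (A := A) (y := x) hy c₆ c₅ c₄
  have e₄ := yangBaxter_three_expand (A := A) (y := y) hx c₃ c₂ c₁
  rw [mul_assoc, mul_assoc, ← mul_assoc (y + algebraMap K A c₄), e₁, e₂,
    mul_assoc (_ * _ * _), mul_assoc (_ * _ * _), ← mul_assoc (x + algebraMap K A c₃), e₃, e₄]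
  simp only [mul_add, add_mul, smul_mul_assoc, mul_smul_comm, one_mul, mul_one, hx, hy, hx', hy',
    mul_assoc, smul_add, smul_sub, mul_sub, smul_smul]
  match_scalars
  all_goals first
    | ring1
    | linear_combination key₁
    | linear_combination -key₁
    | linear_combination key₂
    | linear_combination -key₂

end RankTwo

/-! ### Rank two root strings and the orders of s_i s_j -/

section RankTwoRoots

variable {ι Λ Λ' : Type*} [AddCommGroup Λ] [AddCommGroup Λ']
  {P : RootDatum ι Λ Λ'} (b : P.Base)

/-- Coordinates of the successive roots `α_i, s_i α_j, s_i s_j α_i, …` with respect to `α_i`, `α_j`,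
where `s_i α_j = α_j + a α_i` and `s_j α_i = α_i + a' α_j`. -/
def dihedralCoord : ℤ → ℤ → ℕ → ℤ × ℤ
  | _, _, 0 => (1, 0)
  | a, a', n + 1 =>
    (a * (dihedralCoord a' a n).1 - (dihedralCoord a' a n).2, (dihedralCoord a' a n).1)

lemma root_altProd_smul (i j : b.support) (n : ℕ) :
    P.root (altProd (simpleRefl b i) (simpleRefl b j) n • ((altLetter i j n : b.support) : ι)) =
      (dihedralCoord (-P.pairing j i) (-P.pairing i j) n).1 • P.root i +
        (dihedralCoord (-P.pairing j i) (-P.pairing i j) n).2 • P.root j := by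
  induction n generalizing i j with
  | zero => simp [altProd, altLetter, dihedralCoord]
  | succ n ih =>
    rw [altProd, altLetter, mul_smul, root_smul, ih j i, smul_add, smul_comm _ (_ : ℤ),
      smul_comm _ (_ : ℤ), simpleRefl, ofIdx_smul_root, ofIdx_smul_root, P.pairing_same,
      dihedralCoord]
    module

variable [Finite ι] [P.IsReduced]

omit [Finite ι] [P.IsReduced] in
lemma isPos_altProd_smul_iff (i j : b.support) (n : ℕ) :
    b.IsPos (altProd (simpleRefl b i) (simpleRefl b j) n • ((altLetter i j n : b.support) : ι)) ↔
      0 < (dihedralCoord (-P.pairing j i) (-P.pairing i j) n).1 +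
        (dihedralCoord (-P.pairing j i) (-P.pairing i j) n).2 := by
  rw [b.isPos_iff, height_eq_of_root_eq (root_altProd_smul b i j n),
    RootPairing.Base.height_one_of_mem_support i.2, RootPairing.Base.height_one_of_mem_support j.2,
    mul_one, mul_one]

/-- At the order, the alternating product may be rewritten to start with the other letter; its last
letter is then the one in question, hence a descent. -/
lemma not_isPos_altProd_orderOf_smul (i j : b.support) :
    ¬ b.IsPos (altProd (simpleRefl b i) (simpleRefl b j)
        (orderOf (simpleRefl b i * simpleRefl b j)) •
      ((altLetter i j (orderOf (simpleRefl b i * simpleRefl b j)) : b.support) : ι)) := by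
  rw [altProd_simpleRefl_comm]
  have hpos := orderOf_simpleRefl_mul_pos b i j
  obtain ⟨m, hm⟩ := Nat.exists_eq_succ_of_ne_zero hpos.ne'
  have h1 := isPos_altProd_smul b (i := j) (j := i) (n := m)
    (by rw [orderOf_simpleRefl_comm]; lia)
  rw [hm, Nat.succ_eq_add_one, altLetter]
  rw [altProd_simpleRefl_succ, isPos_mul_simpleRefl_smul_self, not_not]
  exact h1

/-- The order is the first index at which the root string turns negative, so it can be computed from
the Cartan integers. -/
lemma orderOf_simpleRefl_mul_eq {i j : b.support} {m : ℕ}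
    (hpos : ∀ n < m, 0 < (dihedralCoord (-P.pairing j i) (-P.pairing i j) n).1 +
      (dihedralCoord (-P.pairing j i) (-P.pairing i j) n).2)
    (hneg : (dihedralCoord (-P.pairing j i) (-P.pairing i j) m).1 +
      (dihedralCoord (-P.pairing j i) (-P.pairing i j) m).2 ≤ 0) :
    orderOf (simpleRefl b i * simpleRefl b j) = m := by
  apply le_antisymm
  · by_contra! h
    have := isPos_altProd_smul b h
    rw [isPos_altProd_smul_iff] at this
    lia
  · by_contra! h
    exact not_isPos_altProd_orderOf_smul b i j
      ((isPos_altProd_smul_iff b i j _).2 (hpos _ h))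

lemma pairing_mem_of_ne {i j : b.support} (hij : i ≠ j) :
    (P.pairing i j, P.pairing j i) ∈
      ({(0, 0), (-1, -1), (-1, -2), (-2, -1), (-1, -3), (-3, -1)} : Set (ℤ × ℤ)) := by
  have hij' : (i : ι) ≠ j := fun h ↦ hij (Subtype.ext h)
  have hp : ∀ k l, P.pairingIn ℤ k l = P.pairing k l := fun k l ↦ P.algebraMap_pairingIn ℤ k l
  have h1 := P.pairingIn_pairingIn_mem_set_of_isCrystal_of_isRed' (i := i) (j := j)
    (fun h ↦ hij' (P.root.injective h)) (b.root_ne_neg_of_ne i.2 j.2 hij')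
  have h2 := b.pairingIn_le_zero_of_ne hij' i.2 j.2
  rw [hp, hp] at h1
  rw [hp] at h2
  simp only [Set.mem_insert_iff, Set.mem_singleton_iff, Prod.mk.injEq] at h1 ⊢
  lia

end RankTwoRoots

/-! ### The Yang–Baxter equation for roots -/

section YangBaxterWord

variable {ι Λ Λ' : Type*} [AddCommGroup Λ] [Module.Free ℤ Λ] [AddCommGroup Λ']
  {P : RootDatum ι Λ Λ'} (b : P.Base) {A : Type*} [Ring A] [Algebra (CoeffRing Λ) A]
  (η : b.support → A)

/-- The product of the factors `η i + (t₁ + t₂) / E(w' α_i)` along a word, where `w'` is the product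
of `w` and of the preceding letters. -/
def shiftedProd : P.weylGroup → List b.support → A
  | _, [] => 1
  | w, i :: l => (η i + algebraMap (CoeffRing Λ) A (shift (w • P.root i))) *
      shiftedProd (w * simpleRefl b i) l

lemma shiftedProd_append (w : P.weylGroup) (l l' : List b.support) :
    shiftedProd b η w (l ++ l') = shiftedProd b η w l * shiftedProd b η (w * wordProd b l) l' := by
  induction l generalizing w with
  | nil => simp [shiftedProd]
  | cons i l ih => simp [shiftedProd, ih, mul_assoc]

variable {b η} in
lemma shiftedProd_altWord_succ {i j : b.support} {n : ℕ} {x y : ℤ}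
    (h : dihedralCoord (-P.pairing j i) (-P.pairing i j) n = (x, y)) :
    shiftedProd b η 1 (altWord i j (n + 1)) = shiftedProd b η 1 (altWord i j n) *
      (η (altLetter i j n) +
        algebraMap (CoeffRing Λ) A (shift (x • P.root i + y • P.root j))) := by
  have h2 := root_altProd_smul b i j n
  rw [h, root_smul] at h2
  rw [altWord_succ, shiftedProd_append, shiftedProd, shiftedProd, mul_one, one_mul, wordProd_altWord, h2]

-- Coordinates stay in the order (i, j), so that both words are seen to meet the same roots, in
-- opposite orders.
variable {b η} in
lemma shiftedProd_altWord_succ_swap {i j : b.support} {n : ℕ} {x y : ℤ}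
    (h : dihedralCoord (-P.pairing i j) (-P.pairing j i) n = (y, x)) :
    shiftedProd b η 1 (altWord j i (n + 1)) = shiftedProd b η 1 (altWord j i n) *
      (η (altLetter j i n) +
        algebraMap (CoeffRing Λ) A (shift (x • P.root i + y • P.root j))) := by
  rw [shiftedProd_altWord_succ h, add_comm (y • _)]

omit [Module.Free ℤ Λ] in
lemma zsmul_add_zsmul_ne_zero {i j : b.support} (hij : i ≠ j) {x y : ℤ} (h : x ≠ 0 ∨ y ≠ 0) :
    x • P.root i + y • P.root j ≠ 0 := by
  intro h0
  have h1 := LinearIndependent.pair_iff.1 (b.linearIndependent_pair_of_ne hij) x y h0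
  lia

lemma shift_mul_shift_root {i j : b.support} (hij : i ≠ j) {x y x' y' x'' y'' : ℤ}
    (h : x ≠ 0 ∨ y ≠ 0) (h' : x' ≠ 0 ∨ y' ≠ 0) (h'' : x'' ≠ 0 ∨ y'' ≠ 0)
    (hx : x'' = x + x') (hy : y'' = y + y') :
    shift (x • P.root i + y • P.root j) * shift (x' • P.root i + y' • P.root j) =
      shift (x'' • P.root i + y'' • P.root j) *
      (shift (x • P.root i + y • P.root j) + shift (x' • P.root i + y' • P.root j) +
        algebraMap ParamRing (CoeffRing Λ) (t₁ + t₂)) := by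
  have hsum : x'' • P.root i + y'' • P.root j =
      (x • P.root i + y • P.root j) + (x' • P.root i + y' • P.root j) := by
    rw [hx, hy]; module
  rw [hsum]
  refine shift_mul_shift (zsmul_add_zsmul_ne_zero b hij h) (zsmul_add_zsmul_ne_zero b hij h') ?_
  rw [← hsum]
  exact zsmul_add_zsmul_ne_zero b hij h''

variable [Finite ι] [P.IsReduced]

/-- The **Yang–Baxter equation**, up to the braid relation. -/
theorem shiftedProd_altWord_sub (hη : ∀ i, η i * η i =
      algebraMap ParamRing (CoeffRing Λ) (t₁ + t₂) • η i -
        algebraMap ParamRing (CoeffRing Λ) (t₁ * t₂) • 1) {i j : b.support} (hij : i ≠ j) :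
    shiftedProd b η 1 (altWord i j (orderOf (simpleRefl b i * simpleRefl b j))) -
        shiftedProd b η 1 (altWord j i (orderOf (simpleRefl b i * simpleRefl b j))) =
      altProd (η i) (η j) (orderOf (simpleRefl b i * simpleRefl b j)) -
        altProd (η j) (η i) (orderOf (simpleRefl b i * simpleRefl b j)) := by
  -- Exchanging i and j negates both sides, so one orientation of each of A₁×A₁, A₂, B₂, G₂
  -- suffices.
  wlog h : P.pairing i j = 0 ∧ P.pairing j i = 0 ∨ P.pairing i j = -1 ∧
    (P.pairing j i = -1 ∨ P.pairing j i = -2 ∨ P.pairing j i = -3) generalizing i j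
  · have h1 := pairing_mem_of_ne b hij
    simp only [Set.mem_insert_iff, Set.mem_singleton_iff, Prod.mk.injEq] at h1
    have h2 := this hij.symm (by lia)
    rw [orderOf_simpleRefl_comm, ← neg_inj, neg_sub, neg_sub]
    exact h2
  obtain ⟨h1, h2⟩ | ⟨h1, h2 | h2 | h2⟩ := h
  · have hm : orderOf (simpleRefl b i * simpleRefl b j) = 2 := by
      apply orderOf_simpleRefl_mul_eq
      · intro n hn
        rw [h1, h2]
        interval_cases n <;> decide
      · rw [h1, h2]
        decide
    rw [hm]
    rw [shiftedProd_altWord_succ (n := 1) (x := 0) (y := 1) (by rw [h1, h2]; rfl),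
      shiftedProd_altWord_succ (n := 0) (x := 1) (y := 0) (by rw [h1, h2]; rfl),
      shiftedProd_altWord_succ_swap (n := 1) (x := 1) (y := 0) (by rw [h1, h2]; rfl),
      shiftedProd_altWord_succ_swap (n := 0) (x := 0) (y := 1) (by rw [h1, h2]; rfl)]
    simp only [altWord, altLetter, altProd, shiftedProd, one_mul, mul_one]
    exact yangBaxter_two _ _
  · have hm : orderOf (simpleRefl b i * simpleRefl b j) = 3 := by
      apply orderOf_simpleRefl_mul_eq
      · intro n hn
        rw [h1, h2]
        interval_cases n <;> decide
      · rw [h1, h2]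
        decide
    rw [hm]
    rw [shiftedProd_altWord_succ (n := 2) (x := 0) (y := 1) (by rw [h1, h2]; rfl),
      shiftedProd_altWord_succ (n := 1) (x := 1) (y := 1) (by rw [h1, h2]; rfl),
      shiftedProd_altWord_succ (n := 0) (x := 1) (y := 0) (by rw [h1, h2]; rfl),
      shiftedProd_altWord_succ_swap (n := 2) (x := 1) (y := 0) (by rw [h1, h2]; rfl),
      shiftedProd_altWord_succ_swap (n := 1) (x := 1) (y := 1) (by rw [h1, h2]; rfl),
      shiftedProd_altWord_succ_swap (n := 0) (x := 0) (y := 1) (by rw [h1, h2]; rfl)]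
    simp only [altWord, altLetter, altProd, shiftedProd, one_mul, mul_one]
    exact yangBaxter_three (hη i) (hη j)
      (shift_mul_shift_root b hij (by decide) (by decide) (by decide) (by decide) (by decide))
  · have hm : orderOf (simpleRefl b i * simpleRefl b j) = 4 := by
      apply orderOf_simpleRefl_mul_eq
      · intro n hn
        rw [h1, h2]
        interval_cases n <;> decide
      · rw [h1, h2]
        decide
    rw [hm]
    rw [shiftedProd_altWord_succ (n := 3) (x := 0) (y := 1) (by rw [h1, h2]; rfl),
      shiftedProd_altWord_succ (n := 2) (x := 1) (y := 1) (by rw [h1, h2]; rfl),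
      shiftedProd_altWord_succ (n := 1) (x := 2) (y := 1) (by rw [h1, h2]; rfl),
      shiftedProd_altWord_succ (n := 0) (x := 1) (y := 0) (by rw [h1, h2]; rfl),
      shiftedProd_altWord_succ_swap (n := 3) (x := 1) (y := 0) (by rw [h1, h2]; rfl),
      shiftedProd_altWord_succ_swap (n := 2) (x := 2) (y := 1) (by rw [h1, h2]; rfl),
      shiftedProd_altWord_succ_swap (n := 1) (x := 1) (y := 1) (by rw [h1, h2]; rfl),
      shiftedProd_altWord_succ_swap (n := 0) (x := 0) (y := 1) (by rw [h1, h2]; rfl)]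
    simp only [altWord, altLetter, altProd, shiftedProd, one_mul, mul_one]
    exact yangBaxter_four (hη i) (hη j)
      (shift_mul_shift_root b hij (by decide) (by decide) (by decide) (by decide) (by decide))
      (shift_mul_shift_root b hij (by decide) (by decide) (by decide) (by decide) (by decide))
  · have hm : orderOf (simpleRefl b i * simpleRefl b j) = 6 := by
      apply orderOf_simpleRefl_mul_eq
      · intro n hn
        rw [h1, h2]
        interval_cases n <;> decide
      · rw [h1, h2]
        decide
    rw [hm]
    rw [shiftedProd_altWord_succ (n := 5) (x := 0) (y := 1) (by rw [h1, h2]; rfl),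
      shiftedProd_altWord_succ (n := 4) (x := 1) (y := 1) (by rw [h1, h2]; rfl),
      shiftedProd_altWord_succ (n := 3) (x := 3) (y := 2) (by rw [h1, h2]; rfl),
      shiftedProd_altWord_succ (n := 2) (x := 2) (y := 1) (by rw [h1, h2]; rfl),
      shiftedProd_altWord_succ (n := 1) (x := 3) (y := 1) (by rw [h1, h2]; rfl),
      shiftedProd_altWord_succ (n := 0) (x := 1) (y := 0) (by rw [h1, h2]; rfl),
      shiftedProd_altWord_succ_swap (n := 5) (x := 1) (y := 0) (by rw [h1, h2]; rfl),
      shiftedProd_altWord_succ_swap (n := 4) (x := 3) (y := 1) (by rw [h1, h2]; rfl),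
      shiftedProd_altWord_succ_swap (n := 3) (x := 2) (y := 1) (by rw [h1, h2]; rfl),
      shiftedProd_altWord_succ_swap (n := 2) (x := 3) (y := 2) (by rw [h1, h2]; rfl),
      shiftedProd_altWord_succ_swap (n := 1) (x := 1) (y := 1) (by rw [h1, h2]; rfl),
      shiftedProd_altWord_succ_swap (n := 0) (x := 0) (y := 1) (by rw [h1, h2]; rfl)]
    simp only [altWord, altLetter, altProd, shiftedProd, one_mul, mul_one]
    exact yangBaxter_six (hη i) (hη j)
      (shift_mul_shift_root b hij (by decide) (by decide) (by decide) (by decide) (by decide))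
      (shift_mul_shift_root b hij (by decide) (by decide) (by decide) (by decide) (by decide))
      (shift_mul_shift_root b hij (by decide) (by decide) (by decide) (by decide) (by decide))
      (shift_mul_shift_root b hij (by decide) (by decide) (by decide) (by decide) (by decide))
      (shift_mul_shift_root b hij (by decide) (by decide) (by decide) (by decide) (by decide))

end YangBaxterWord

/-! ### Evaluating scalar extensions as operators -/

section Evaluation

variable {Λ : Type*} [AddCommGroup Λ] [Module.Free ℤ Λ] {F : Type*} [Ring F] [Algebra ParamRing F]
  (ψ : F →ₐ[ParamRing] Module.End ParamRing (CoeffRing Λ))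

/-- Extension of a representation on `Q_{t₁,t₂}(Λ)` to scalars from `Q_{t₁,t₂}(Λ)`, acting by
multiplication after the operators. -/
def evalOperator : CoeffRing Λ ⊗[ParamRing] F →ₗ[CoeffRing Λ] Module.End ParamRing (CoeffRing Λ) :=
  ψ.toLinearMap.liftBaseChange (CoeffRing Λ)

@[simp]
lemma evalOperator_tmul (c : CoeffRing Λ) (f : F) : evalOperator ψ (c ⊗ₜ f) = c • ψ f :=
  LinearMap.liftBaseChange_tmul _ _ _ _

lemma evalOperator_one : evalOperator ψ 1 = 1 := by
  rw [Algebra.TensorProduct.one_def, evalOperator_tmul, one_smul, map_one]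

/-- Scalars are central in the tensor product but need not commute with the operators, so
multiplicativity is claimed only for right factors 1 ⊗ f. -/
lemma evalOperator_mul_one_tmul (x : CoeffRing Λ ⊗[ParamRing] F) (f : F) :
    evalOperator ψ (x * (1 ⊗ₜ f)) = evalOperator ψ x * ψ f := by
  induction x with
  | zero => simp
  | tmul c g =>
    rw [Algebra.TensorProduct.tmul_mul_tmul, mul_one, evalOperator_tmul, evalOperator_tmul,
      map_mul, smul_mul_assoc]
  | add x y hx hy => rw [add_mul, map_add, hx, hy, map_add, add_mul]

lemma evalOperator_mul_algebraMap (x : CoeffRing Λ ⊗[ParamRing] F) (c : CoeffRing Λ) :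
    evalOperator ψ (x * algebraMap (CoeffRing Λ) _ c) = c • evalOperator ψ x := by
  rw [← Algebra.commutes, ← Algebra.smul_def, map_smul]

end Evaluation

/-! ### Demazure–Lusztig operators -/

section Operators

variable {ι Λ Λ' : Type*} [AddCommGroup Λ] [Module.Free ℤ Λ] [AddCommGroup Λ']
  {P : RootDatum ι Λ Λ'}

/-- The action of the Weyl group on `Q_{t₁,t₂}(Λ)`, by linear operators. -/
def weylOperator (w : P.weylGroup) : Module.End ParamRing (CoeffRing Λ) :=
  (weylAct w).toLinearMap

variable (b : P.Base)

/-- The Demazure–Lusztig operator `f ↦ (c + t₁) s_i(f) - c f`, where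
`c = (t₁ + t₂) / E(α_i)`. -/
def demazureLusztig (i : b.support) : Module.End ParamRing (CoeffRing Λ) :=
  (shift (P.root i) + algebraMap ParamRing (CoeffRing Λ) t₁) • weylOperator (simpleRefl b i) -
    shift (P.root i) • 1

lemma demazureLusztig_apply (i : b.support) (f : CoeffRing Λ) :
    demazureLusztig b i f = (shift (P.root i) + algebraMap ParamRing (CoeffRing Λ) t₁) *
      weylAct (simpleRefl b i) f - shift (P.root i) * f := rfl

lemma demazureLusztig_mul_self (i : b.support) :
    demazureLusztig b i * demazureLusztig b i =
      (t₁ + t₂) • demazureLusztig b i - (t₁ * t₂) • 1 := by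
  have h0 : P.root i ≠ 0 := P.ne_zero i
  have h1 : simpleRefl b i • P.root i = -P.root i := by
    rw [← root_smul, root_simpleRefl_smul_self]
  refine LinearMap.ext fun f ↦ ?_
  rw [Module.End.mul_apply, LinearMap.sub_apply, LinearMap.smul_apply, LinearMap.smul_apply,
    Module.End.one_apply, demazureLusztig_apply, demazureLusztig_apply, map_sub, map_mul, map_mul,
    map_add, AlgHom.commutes, weylAct_shift, h1, shift_neg h0, weylAct_weylAct,
    simpleRefl_mul_self, weylAct_one, Algebra.smul_def, Algebra.smul_def, map_add, map_mul]
  ring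

variable {F : Type*} [Ring F] [Algebra ParamRing F]
  (ψ : F →ₐ[ParamRing] Module.End ParamRing (CoeffRing Λ))

/-- Moving w past T_i turns its shift c into w(c), the shift of wα_i. The added scalar cancels the
term -w(c)·w, and only the multiple of w s_i remains. -/
lemma evalOperator_mul_shift {x : CoeffRing Λ ⊗[ParamRing] F} {B : CoeffRing Λ} {w : P.weylGroup}
    (hx : evalOperator ψ x = B • weylOperator w) {i : b.support} {f : F}
    (hf : ψ f = demazureLusztig b i) :
    evalOperator ψ (x * (1 ⊗ₜ f + algebraMap (CoeffRing Λ) _ (shift (w • P.root i)))) =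
      (B * (shift (w • P.root i) + algebraMap ParamRing (CoeffRing Λ) t₁)) •
        weylOperator (w * simpleRefl b i) := by
  rw [mul_add, map_add, evalOperator_mul_one_tmul, evalOperator_mul_algebraMap, hx, hf]
  refine LinearMap.ext fun g ↦ ?_
  change B * weylAct w (demazureLusztig b i g) + shift (w • P.root i) * (B * weylAct w g) =
    (B * (shift (w • P.root i) + algebraMap ParamRing (CoeffRing Λ) t₁)) *
      weylAct (w * simpleRefl b i) g
  rw [demazureLusztig_apply, map_sub, map_mul, map_mul, map_add, AlgHom.commutes, weylAct_shift,
    weylAct_weylAct]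
  ring

variable [Finite ι]

/-- The product of `(t₁ + t₂) / E(β) + t₁` over the positive roots `β` made negative by `w⁻¹`. -/
def inversionFactor (w : P.weylGroup) : CoeffRing Λ :=
  ∏ k ∈ (Set.toFinite {k : ι | b.IsPos k ∧ ¬ b.IsPos (w⁻¹ • k)}).toFinset,
    (shift (P.root k) + algebraMap ParamRing (CoeffRing Λ) t₁)

lemma inversionFactor_one : inversionFactor b 1 = 1 := by
  apply Finset.prod_eq_one
  intro k hk
  simp at hk

lemma inversionFactor_ne_zero (w : P.weylGroup) : inversionFactor b w ≠ 0 :=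
  Finset.prod_ne_zero_iff.2 fun k _ ↦ shift_add_ne_zero (P.ne_zero k)

variable [P.IsReduced]

/-- At an ascent the inversion set gains exactly the root wα_i, because s_i permutes the other
positive roots. -/
lemma inversionFactor_mul_simpleRefl {w : P.weylGroup} {i : b.support}
    (h : b.IsPos (w • (i : ι))) :
    inversionFactor b (w * simpleRefl b i) =
      inversionFactor b w *
        (shift (w • P.root i) + algebraMap ParamRing (CoeffRing Λ) t₁) := by
  classical
  have hsi : ¬ b.IsPos (simpleRefl b i • (i : ι)) := by
    have := isPos_mul_simpleRefl_smul_self b 1 i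
    rw [one_mul, one_smul] at this
    rw [this, not_not]
    exact isPos_support b i
  have hset : (Set.toFinite {k : ι | b.IsPos k ∧ ¬ b.IsPos ((w * simpleRefl b i)⁻¹ • k)}).toFinset =
      insert (w • (i : ι)) (Set.toFinite {k : ι | b.IsPos k ∧ ¬ b.IsPos (w⁻¹ • k)}).toFinset := by
    ext k
    simp only [Set.Finite.mem_toFinset, Set.mem_ofPred_eq, Finset.mem_insert, mul_inv_rev,
      simpleRefl_inv, mul_smul]
    constructor
    · rintro ⟨h1, h2⟩
      by_cases hk : w⁻¹ • k = i
      · left; rw [← hk, smul_inv_smul]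
      · right
        exact ⟨h1, fun h3 ↦ h2 (isPos_simpleRefl_smul h3 hk)⟩
    · rintro (rfl | ⟨h1, h2⟩)
      · exact ⟨h, by rwa [inv_smul_smul]⟩
      · refine ⟨h1, fun h3 ↦ ?_⟩
        have h4 : simpleRefl b i • w⁻¹ • k ≠ i := by
          intro h4
          have h5 : k = (w * simpleRefl b i) • (i : ι) := by
            rw [← h4, ← mul_smul, ← mul_smul, mul_simpleRefl_cancel, mul_inv_cancel,
              one_smul]
          rw [h5, isPos_mul_simpleRefl_smul_self] at h1
          exact h1 h
        have h5 := isPos_simpleRefl_smul h3 h4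
        rw [← mul_smul, simpleRefl_mul_self, one_smul] at h5
        exact h2 h5
  rw [inversionFactor, hset, Finset.prod_insert, mul_comm, inversionFactor, root_smul]
  simp [isPos_support]

/-- The value depends on w only, not on the reduced word; no braid relation enters. -/
lemma evalOperator_shiftedProd {f : b.support → F} (hf : ∀ i, ψ (f i) = demazureLusztig b i)
    {w : P.weylGroup} {l : List b.support} (hl : IsReducedWord b l w) :
    evalOperator ψ (shiftedProd b (fun i ↦ (1 : CoeffRing Λ) ⊗ₜ[ParamRing] f i) 1 l) =
      inversionFactor b w • weylOperator w := by
  induction l using List.reverseRecOn generalizing w with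
  | nil =>
    have hw : w = 1 := hl.1.symm
    rw [hw, shiftedProd, evalOperator_one, inversionFactor_one, one_smul]
    exact LinearMap.ext fun x ↦ (weylAct_one x).symm
  | append_singleton l i ih =>
    obtain ⟨h1, h2⟩ := length_append_singleton_of_isReducedWord b hl
    have h3 := ih h1
    have h4 : b.IsPos ((w * simpleRefl b i) • (i : ι)) :=
      (isPos_mul_simpleRefl_smul_self b w i).2 h2
    have h5 := evalOperator_mul_shift b ψ h3 (hf i)
    rw [← inversionFactor_mul_simpleRefl b h4, mul_simpleRefl_cancel] at h5
    rw [shiftedProd_append, shiftedProd, shiftedProd, mul_one, one_mul, h1.1]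
    exact h5

/-- The Demazure–Lusztig operators satisfy the braid relations. -/
theorem demazureLusztig_braid {i j : b.support} (hij : i ≠ j) :
    altProd (demazureLusztig b i) (demazureLusztig b j)
        (orderOf (simpleRefl b i * simpleRefl b j)) =
      altProd (demazureLusztig b j) (demazureLusztig b i)
        (orderOf (simpleRefl b i * simpleRefl b j)) := by
  let ψ := AlgHom.id ParamRing (Module.End ParamRing (CoeffRing Λ))
  have h1 := evalOperator_shiftedProd b ψ (f := demazureLusztig b) (fun i ↦ rfl)
    (isReducedWord_altWord b i j le_rfl)
  have h2 := evalOperator_shiftedProd b ψ (f := demazureLusztig b) (fun i ↦ rfl)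
    (isReducedWord_altWord b j i (orderOf_simpleRefl_comm b i j).le)
  rw [← altProd_simpleRefl_comm, ← h1] at h2
  let η : b.support → CoeffRing Λ ⊗[ParamRing] Module.End ParamRing (CoeffRing Λ) :=
    fun i ↦ 1 ⊗ₜ demazureLusztig b i
  have h3 := shiftedProd_altWord_sub b η (fun i ↦ by
    simp only [η, Algebra.TensorProduct.tmul_mul_tmul, mul_one, demazureLusztig_mul_self,
      algebraMap_smul, TensorProduct.tmul_sub, TensorProduct.tmul_smul,
      Algebra.TensorProduct.one_def]) hij
  have h4 := congr(evalOperator ψ $h3)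
  -- Both shifted products belong to reduced words of one element, so they evaluate alike;
  -- Yang–Baxter then says that the braid words do too.
  rw [map_sub, map_sub, sub_eq_zero.2 h2.symm, eq_comm, sub_eq_zero] at h4
  have h5 : ∀ (i j : b.support) (n : ℕ), altProd (η i) (η j) n =
      1 ⊗ₜ altProd (demazureLusztig b i) (demazureLusztig b j) n := fun i j n ↦
    (map_altProd (Algebra.TensorProduct.includeRight : _ →ₐ[ParamRing]
      CoeffRing Λ ⊗[ParamRing] Module.End ParamRing (CoeffRing Λ)) _ _ n).symm
  rw [h5, h5, evalOperator_tmul, evalOperator_tmul, one_smul, one_smul] at h4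
  exact h4

end Operators

/-! ### The Hecke algebra and its spanning set h_w -/

section GenericHeckeAlgebra

variable {ι Λ Λ' : Type*} [AddCommGroup Λ] [AddCommGroup Λ']
  {P : RootDatum ι Λ Λ'} (b : P.Base)

lemma gen_mul_self (i : b.support) :
    gen b i * gen b i = (t₁ + t₂) • gen b i - (t₁ * t₂) • 1 := by
  have h := RingQuot.mkAlgHom_rel ParamRing (HeckeRel.quadratic (b := b) i)
  rw [map_zero, map_mul, map_sub, map_sub, AlgHom.commutes, AlgHom.commutes] at h
  change (gen b i - algebraMap ParamRing (GenericHecke b) t₁) *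
    (gen b i - algebraMap ParamRing (GenericHecke b) t₂) = 0 at h
  rw [Algebra.algebraMap_eq_smul_one, Algebra.algebraMap_eq_smul_one, mul_sub, sub_mul, sub_mul,
    mul_smul_comm, mul_one, smul_mul_assoc, one_mul, smul_mul_smul_comm, one_mul] at h
  have h1 : gen b i * gen b i = (gen b i * gen b i - t₁ • gen b i -
      (t₂ • gen b i - (t₁ * t₂) • 1)) + ((t₁ + t₂) • gen b i - (t₁ * t₂) • 1) := by module
  rw [h, zero_add] at h1
  exact h1

lemma gen_braid {i j : b.support} (hij : i ≠ j) :
    altProd (gen b i) (gen b j) (orderOf (simpleRefl b i * simpleRefl b j)) =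
      altProd (gen b j) (gen b i) (orderOf (simpleRefl b i * simpleRefl b j)) := by
  have h := RingQuot.mkAlgHom_rel ParamRing (HeckeRel.braid (b := b) i j hij)
  rwa [map_altProd, map_altProd] at h

variable {b} in
/-- The universal property of the generic Hecke algebra. -/
def heckeLift {A : Type*} [Ring A] [Algebra ParamRing A] (g : b.support → A)
    (hq : ∀ i, g i * g i = (t₁ + t₂) • g i - (t₁ * t₂) • 1)
    (hb : ∀ i j, i ≠ j → altProd (g i) (g j) (orderOf (simpleRefl b i * simpleRefl b j)) =
      altProd (g j) (g i) (orderOf (simpleRefl b i * simpleRefl b j))) :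
    GenericHecke b →ₐ[ParamRing] A :=
  RingQuot.liftAlgHom ParamRing ⟨FreeAlgebra.lift ParamRing g, fun x y h ↦ by
    induction h with
    | quadratic i =>
      rw [map_zero, map_mul, map_sub, map_sub, AlgHom.commutes, AlgHom.commutes,
        FreeAlgebra.lift_ι_apply, Algebra.algebraMap_eq_smul_one, Algebra.algebraMap_eq_smul_one,
        mul_sub, sub_mul, sub_mul, mul_smul_comm, mul_one, smul_mul_assoc, one_mul,
        smul_mul_smul_comm, one_mul, hq]
      module
    | braid i j hij =>
      rw [map_altProd, map_altProd, FreeAlgebra.lift_ι_apply, FreeAlgebra.lift_ι_apply]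
      exact hb i j hij⟩

@[simp]
lemma heckeLift_gen {A : Type*} [Ring A] [Algebra ParamRing A] (g : b.support → A)
    (hq : ∀ i, g i * g i = (t₁ + t₂) • g i - (t₁ * t₂) • 1)
    (hb : ∀ i j, i ≠ j → altProd (g i) (g j) (orderOf (simpleRefl b i * simpleRefl b j)) =
      altProd (g j) (g i) (orderOf (simpleRefl b i * simpleRefl b j))) (i : b.support) :
    heckeLift g hq hb (gen b i) = g i := by
  rw [heckeLift, gen]
  erw [RingQuot.liftAlgHom_mkAlgHom_apply]
  exact FreeAlgebra.lift_ι_apply _ _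

variable [Module.Free ℤ Λ]

/-- The inclusion of the generic Hecke algebra in its extension of scalars. -/
def ofGeneric : GenericHecke b →+* Hecke b :=
  (Algebra.TensorProduct.includeRight :
    GenericHecke b →ₐ[ParamRing] CoeffRing Λ ⊗[ParamRing] GenericHecke b).toRingHom

lemma ofGeneric_algebraMap (r : ParamRing) :
    ofGeneric b (algebraMap ParamRing (GenericHecke b) r) =
      algebraMap (CoeffRing Λ) (Hecke b) (algebraMap ParamRing (CoeffRing Λ) r) :=
  ((Algebra.TensorProduct.includeRight :
    GenericHecke b →ₐ[ParamRing] CoeffRing Λ ⊗[ParamRing] GenericHecke b).commutes r).trans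
    (IsScalarTower.algebraMap_apply ParamRing (CoeffRing Λ)
      (CoeffRing Λ ⊗[ParamRing] GenericHecke b) r)

lemma hSimple_braid {i j : b.support} (hij : i ≠ j) :
    altProd (hSimple b i) (hSimple b j) (orderOf (simpleRefl b i * simpleRefl b j)) =
      altProd (hSimple b j) (hSimple b i) (orderOf (simpleRefl b i * simpleRefl b j)) := by
  have h := congrArg (ofGeneric b) (gen_braid b hij)
  rw [map_altProd, map_altProd] at h
  exact h

lemma hSimple_mul_self (i : b.support) :
    hSimple b i * hSimple b i =
      algebraMap ParamRing (CoeffRing Λ) (t₁ + t₂) • hSimple b i -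
        algebraMap ParamRing (CoeffRing Λ) (t₁ * t₂) • 1 := by
  have h : (1 ⊗ₜ gen b i : CoeffRing Λ ⊗[ParamRing] GenericHecke b) * (1 ⊗ₜ gen b i) =
      algebraMap ParamRing (CoeffRing Λ) (t₁ + t₂) • (1 ⊗ₜ gen b i) -
        algebraMap ParamRing (CoeffRing Λ) (t₁ * t₂) • 1 := by
    simp only [Algebra.TensorProduct.tmul_mul_tmul, mul_one, gen_mul_self,
      algebraMap_smul, TensorProduct.tmul_sub, TensorProduct.tmul_smul,
      Algebra.TensorProduct.one_def]
  exact h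

lemma onCoeffs_hSimple (f : CoeffRing Λ →ₐ[ParamRing] CoeffRing Λ) (i : b.support) :
    onCoeffs b f (hSimple b i) = hSimple b i := by
  have h : Algebra.TensorProduct.map f (AlgHom.id ParamRing (GenericHecke b)) (1 ⊗ₜ gen b i) =
      1 ⊗ₜ gen b i := by
    rw [Algebra.TensorProduct.map_tmul, map_one, AlgHom.id_apply]
  exact h

lemma onCoeffs_algebraMap (f : CoeffRing Λ →ₐ[ParamRing] CoeffRing Λ) (c : CoeffRing Λ) :
    onCoeffs b f (algebraMap (CoeffRing Λ) (Hecke b) c) =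
      algebraMap (CoeffRing Λ) (Hecke b) (f c) := by
  have h : Algebra.TensorProduct.map f (AlgHom.id ParamRing (GenericHecke b)) (c ⊗ₜ 1) =
      f c ⊗ₜ 1 := by
    rw [Algebra.TensorProduct.map_tmul, map_one]
  exact h

lemma onCoeffs_smul (f : CoeffRing Λ →ₐ[ParamRing] CoeffRing Λ) (c : CoeffRing Λ) (x : Hecke b) :
    onCoeffs b f (c • x) = f c • onCoeffs b f x := by
  rw [Algebra.smul_def, map_mul, onCoeffs_algebraMap, Algebra.smul_def]

lemma onCoeffs_h (f : CoeffRing Λ →ₐ[ParamRing] CoeffRing Λ) (w : P.weylGroup) :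
    onCoeffs b f (h b w) = h b w := by
  rw [h, map_list_prod, List.map_map]
  congr 2
  exact funext fun i ↦ onCoeffs_hSimple b f i

variable [Finite ι] [P.IsReduced]

variable {b} in
lemma h_eq_prod {w : P.weylGroup} {l : List b.support} (hl : IsReducedWord b l w) :
    h b w = (l.map (hSimple b)).prod :=
  prod_map_eq_of_isReducedWord b (hSimple b) (fun _ _ hij ↦ hSimple_braid b hij)
    (isReducedWord_reducedWord b w) hl

lemma h_one : h b 1 = 1 :=
  h_eq_prod (l := []) ⟨rfl, by simp⟩

variable {b} in
lemma h_mul_simpleRefl {w : P.weylGroup} {i : b.support} (hi : b.IsPos (w • (i : ι))) :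
    h b (w * simpleRefl b i) = h b w * hSimple b i := by
  have hr := isReducedWord_reducedWord b w
  have hl : IsReducedWord b (reducedWord b w ++ [i]) (w * simpleRefl b i) :=
    ⟨by simp [hr.1], by simp [hr.2, length_mul_simpleRefl_of_isPos b hi]⟩
  rw [h_eq_prod hl, List.map_append, List.prod_append]
  simp [h]

variable {b} in
lemma h_mul_hSimple {w : P.weylGroup} {i : b.support} (hi : ¬ b.IsPos (w • (i : ι))) :
    h b w * hSimple b i = algebraMap ParamRing (CoeffRing Λ) (t₁ + t₂) • h b w -
      algebraMap ParamRing (CoeffRing Λ) (t₁ * t₂) • h b (w * simpleRefl b i) := by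
  have h1 := h_mul_simpleRefl (b := b) (w := w * simpleRefl b i) (i := i)
    ((isPos_mul_simpleRefl_smul_self b w i).2 hi)
  rw [mul_simpleRefl_cancel] at h1
  rw [h1, mul_assoc, hSimple_mul_self, mul_sub, mul_smul_comm, mul_smul_comm, mul_one]

lemma span_range_h : Submodule.span (CoeffRing Λ) (Set.range (h b)) = ⊤ := by
  set S := Submodule.span (CoeffRing Λ) (Set.range (h b)) with hS
  -- The span contains h_e = 1, so stability under right multiplication by the generators is enough.
  have h1 : ∀ (i : b.support) (x : Hecke b), x ∈ S → x * hSimple b i ∈ S := by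
    intro i x hx
    induction hx using Submodule.span_induction with
    | mem x hx =>
      obtain ⟨w, rfl⟩ := hx
      by_cases hi : b.IsPos (w • (i : ι))
      · rw [← h_mul_simpleRefl hi]
        exact Submodule.subset_span ⟨_, rfl⟩
      · rw [h_mul_hSimple hi]
        exact S.sub_mem (S.smul_mem _ (Submodule.subset_span ⟨_, rfl⟩))
          (S.smul_mem _ (Submodule.subset_span ⟨_, rfl⟩))
    | zero => rw [zero_mul]; exact S.zero_mem
    | add x y _ _ hx hy => rw [add_mul]; exact S.add_mem hx hy
    | smul c x _ hx => rw [smul_mul_assoc]; exact S.smul_mem c hx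
  let π : FreeAlgebra ParamRing b.support →ₐ[ParamRing] GenericHecke b :=
    RingQuot.mkAlgHom ParamRing (HeckeRel b)
  have h2 : ∀ (a : FreeAlgebra ParamRing b.support) (x : Hecke b), x ∈ S →
      x * ofGeneric b (π a) ∈ S := by
    intro a
    induction a using FreeAlgebra.induction with
    | grade0 r =>
      intro x hx
      rw [AlgHom.commutes, ofGeneric_algebraMap, ← Algebra.commutes, ← Algebra.smul_def]
      exact S.smul_mem _ hx
    | grade1 i => exact h1 i
    | mul a a' h3 h4 =>
      intro x hx
      rw [map_mul, map_mul, ← mul_assoc]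
      exact h4 _ (h3 x hx)
    | add a a' h3 h4 =>
      intro x hx
      rw [map_add, map_add, mul_add]
      exact S.add_mem (h3 x hx) (h4 x hx)
  rw [eq_top_iff]
  rintro x -
  refine TensorProduct.induction_on (motive := fun x : Hecke b ↦ x ∈ S) x S.zero_mem ?_
    fun x y hx hy ↦ S.add_mem hx hy
  intro c g
  obtain ⟨a, rfl⟩ := RingQuot.mkAlgHom_surjective ParamRing (HeckeRel b) g
  have h3 := h2 a 1 (by rw [← h_one]; exact Submodule.subset_span ⟨_, rfl⟩)
  rw [one_mul] at h3
  have h4 := S.smul_mem c h3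
  have h5 : c ⊗ₜ[ParamRing] (RingQuot.mkAlgHom ParamRing (HeckeRel b) a) =
      c • ((1 : CoeffRing Λ) ⊗ₜ[ParamRing] (RingQuot.mkAlgHom ParamRing (HeckeRel b) a)) := by
    rw [TensorProduct.smul_tmul', smul_eq_mul, mul_one]
  exact (congrArg (· ∈ S) h5).mpr h4

end GenericHeckeAlgebra

/-! ### Faithful evaluation, and the basis h_w -/

section DemazureLusztigRepresentation

variable {ι Λ Λ' : Type*} [Finite ι] [AddCommGroup Λ] [Module.Free ℤ Λ] [AddCommGroup Λ']
  {P : RootDatum ι Λ Λ'} [P.IsReduced] (b : P.Base)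

/-- The representation of the generic Hecke algebra by Demazure–Lusztig operators. -/
def demazureLusztigRep : GenericHecke b →ₐ[ParamRing] Module.End ParamRing (CoeffRing Λ) :=
  heckeLift (demazureLusztig b) (demazureLusztig_mul_self b) fun _ _ ↦ demazureLusztig_braid b

/-- Evaluation of the elements of the Hecke algebra as operators on `Q_{t₁,t₂}(Λ)`. -/
def heckeEval : Hecke b →ₗ[CoeffRing Λ] Module.End ParamRing (CoeffRing Λ) :=
  (evalOperator (demazureLusztigRep b) :
    CoeffRing Λ ⊗[ParamRing] GenericHecke b →ₗ[CoeffRing Λ] Module.End ParamRing (CoeffRing Λ))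

lemma heckeEval_mul_shift {x : Hecke b} {B : CoeffRing Λ} {w : P.weylGroup}
    (hx : heckeEval b x = B • weylOperator w) (i : b.support) :
    heckeEval b (x * (hSimple b i + algebraMap (CoeffRing Λ) (Hecke b) (shift (w • P.root i)))) =
      (B * (shift (w • P.root i) + algebraMap ParamRing (CoeffRing Λ) t₁)) •
        weylOperator (w * simpleRefl b i) :=
  evalOperator_mul_shift b (demazureLusztigRep b) hx (heckeLift_gen b _ _ _ i)

lemma heckeEval_mul_shift_of_isPos {x : Hecke b} {w : P.weylGroup} {i : b.support}
    (hx : heckeEval b x = inversionFactor b (w * simpleRefl b i) • weylOperator (w * simpleRefl b i))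
    (hi : ¬ b.IsPos (w • (i : ι))) :
    heckeEval b (x * (hSimple b i + algebraMap (CoeffRing Λ) (Hecke b)
      (shift ((w * simpleRefl b i) • P.root i)))) = inversionFactor b w • weylOperator w := by
  have h := heckeEval_mul_shift b hx i
  rwa [← inversionFactor_mul_simpleRefl b ((isPos_mul_simpleRefl_smul_self b w i).2 hi),
    mul_simpleRefl_cancel] at h

lemma heckeEval_Y (w : P.weylGroup) : heckeEval b (Y b w) = inversionFactor b w • weylOperator w := by
  induction hn : length b w using Nat.strong_induction_on generalizing w with
  | _ n ih =>
    rw [Y]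
    split_ifs with hw
    · have hlt := hw.choose_spec
      exact heckeEval_mul_shift_of_isPos b (ih _ (hn ▸ hlt) _ rfl)
        ((length_mul_simpleRefl_lt_iff b).1 hlt)
    · have hw1 : w = 1 := by
        by_contra h
        obtain ⟨i, hi⟩ := exists_not_isPos_smul b h
        exact hw ⟨i, (length_mul_simpleRefl_lt_iff b).2 hi⟩
      rw [hw1, inversionFactor_one, one_smul]
      exact (evalOperator_one (demazureLusztigRep b)).trans
        (LinearMap.ext fun x ↦ (weylAct_one x).symm)

-- Dedekind's theorem: distinct multiplicative maps into a domain are linearly independent.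
omit [Finite ι] [P.IsReduced] in
lemma linearIndependent_weylOperator :
    LinearIndependent (CoeffRing Λ)
      (weylOperator : P.weylGroup → Module.End ParamRing (CoeffRing Λ)) := by
  have h1 := linearIndependent_monoidHom (CoeffRing Λ) (CoeffRing Λ)
  have h2 : Function.Injective fun w : P.weylGroup ↦
      ((weylAct w : CoeffRing Λ →ₐ[ParamRing] CoeffRing Λ) : CoeffRing Λ →* CoeffRing Λ) :=
    fun w w' h ↦ weylAct_injective (AlgHom.ext fun x ↦ congr($h x))
  have h3 := h1.comp _ h2
  let f : Module.End ParamRing (CoeffRing Λ) →ₗ[CoeffRing Λ] (CoeffRing Λ → CoeffRing Λ) :=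
    { toFun := fun T ↦ T
      map_add' := fun _ _ ↦ rfl
      map_smul' := fun _ _ ↦ rfl }
  exact LinearIndependent.of_comp f h3

variable [Fintype P.weylGroup]

lemma eq_zero_of_heckeEval_sum_Y_eq_zero {z : P.weylGroup → CoeffRing Λ}
    (h : heckeEval b (∑ w, z w • Y b w) = 0) : z = 0 := by
  simp only [map_sum, map_smul, heckeEval_Y, smul_smul] at h
  funext w
  have h1 := Fintype.linearIndependent_iff.1 linearIndependent_weylOperator _ h w
  exact (mul_eq_zero.1 h1).resolve_right (inversionFactor_ne_zero b w)

/-- Write Y = M h, which is possible as the h_w span. Independence of the Y_w forces det M ≠ 0. The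
coefficients z adj(M) of the Y_w then give det(M)·Σ z_w h_w, which evaluates to zero, so z adj(M) =
0 and det(M) z = 0. The adjugate is used so as not to divide by det M. -/
lemma eq_zero_of_heckeEval_sum_h_eq_zero {z : P.weylGroup → CoeffRing Λ}
    (hz : heckeEval b (∑ w, z w • h b w) = 0) : z = 0 := by
  classical
  have h1 : ∀ v, ∃ m : P.weylGroup → CoeffRing Λ, ∑ w, m w • h b w = Y b v := fun v ↦ by
    rw [← Submodule.mem_span_range_iff_exists_fun, span_range_h]
    exact Submodule.mem_top
  choose M hM using h1
  have h2 : ∀ y : P.weylGroup → CoeffRing Λ,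
      ∑ v, y v • Y b v = ∑ w, Matrix.vecMul y (Matrix.of M) w • h b w := by
    intro y
    simp only [← hM, Finset.smul_sum, smul_smul, Matrix.vecMul, dotProduct, Finset.sum_smul,
      Matrix.of_apply]
    exact Finset.sum_comm
  have hdet : (Matrix.of M).det ≠ 0 := by
    intro h0
    obtain ⟨y, hy, hy0⟩ := Matrix.exists_vecMul_eq_zero_iff.2 h0
    refine hy (eq_zero_of_heckeEval_sum_Y_eq_zero b ?_)
    rw [h2, hy0]
    simp
  have h3 : Matrix.vecMul (Matrix.vecMul z (Matrix.of M).adjugate) (Matrix.of M) =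
      (Matrix.of M).det • z := by
    rw [Matrix.vecMul_vecMul, Matrix.adjugate_mul, Matrix.vecMul_smul, Matrix.vecMul_one]
  have h4 : Matrix.vecMul z (Matrix.of M).adjugate = 0 := by
    refine eq_zero_of_heckeEval_sum_Y_eq_zero b ?_
    rw [h2, h3]
    simp only [Pi.smul_apply, smul_assoc, ← Finset.smul_sum, map_smul, hz, smul_zero]
  rw [h4, Matrix.zero_vecMul] at h3
  exact (smul_eq_zero.1 h3.symm).resolve_left hdet

/-- The basis `h_w` of the Hecke algebra. -/
def heckeBasis : Module.Basis P.weylGroup (CoeffRing Λ) (Hecke b) :=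
  Module.Basis.mk (v := h b)
    (Fintype.linearIndependent_iff.2 fun z hz ↦
      congrFun (eq_zero_of_heckeEval_sum_h_eq_zero b (by rw [hz, map_zero])))
    (span_range_h b).ge

lemma heckeBasis_apply (w : P.weylGroup) : heckeBasis b w = h b w :=
  Module.Basis.mk_apply _ _ _

lemma heckeEval_injective : Function.Injective (heckeEval b) := by
  rw [injective_iff_map_eq_zero]
  intro x hx
  rw [← (heckeBasis b).sum_repr x] at hx ⊢
  simp only [heckeBasis_apply] at hx ⊢
  have := eq_zero_of_heckeEval_sum_h_eq_zero b hx
  simp [this]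

omit [Fintype P.weylGroup] in
/-- The Yang–Baxter elements do not depend on the choice of the descents. -/
lemma Y_eq_mul {w : P.weylGroup} {i : b.support} (hi : ¬ b.IsPos (w • (i : ι))) :
    Y b w = Y b (w * simpleRefl b i) * (hSimple b i + algebraMap (CoeffRing Λ) (Hecke b)
      (shift ((w * simpleRefl b i) • P.root i))) := by
  have := finite_weylGroup b
  have := Fintype.ofFinite P.weylGroup
  apply heckeEval_injective b
  rw [heckeEval_Y, heckeEval_mul_shift_of_isPos b (heckeEval_Y b _) hi]

end DemazureLusztigRepresentation

/-! ### The automorphism Ω and its effect on Y -/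

section LongestElement

variable {ι Λ Λ' : Type*} [Finite ι] [AddCommGroup Λ] [Module.Free ℤ Λ] [AddCommGroup Λ']
  {P : RootDatum ι Λ Λ'} [P.IsReduced] (b : P.Base)

variable {b} in
/-- The endomorphism of the Hecke algebra attached to a symmetry of the simple reflections. -/
def diagramHom (σ : b.support → b.support) (hσ : Function.Injective σ)
    (hord : ∀ i j, orderOf (simpleRefl b (σ i) * simpleRefl b (σ j)) =
      orderOf (simpleRefl b i * simpleRefl b j)) : Hecke b →ₐ[CoeffRing Λ] Hecke b :=
  (Algebra.TensorProduct.map (AlgHom.id (CoeffRing Λ) (CoeffRing Λ))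
    (heckeLift (fun i ↦ gen b (σ i)) (fun i ↦ gen_mul_self b (σ i)) fun i j hij ↦ by
      rw [← hord]
      exact gen_braid b (hσ.ne hij)) :
    CoeffRing Λ ⊗[ParamRing] GenericHecke b →ₐ[CoeffRing Λ] CoeffRing Λ ⊗[ParamRing] GenericHecke b)

omit [Finite ι] [P.IsReduced] in
lemma diagramHom_hSimple (σ : b.support → b.support) (hσ : Function.Injective σ)
    (hord : ∀ i j, orderOf (simpleRefl b (σ i) * simpleRefl b (σ j)) =
      orderOf (simpleRefl b i * simpleRefl b j)) (i : b.support) :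
    diagramHom σ hσ hord (hSimple b i) = hSimple b (σ i) := by
  refine (Algebra.TensorProduct.map_tmul _ _ (1 : CoeffRing Λ) (gen b i)).trans ?_
  rw [heckeLift_gen]
  rfl

variable {b} {w₀ : P.weylGroup} (hw₀ : ∀ w, length b w ≤ length b w₀)

/-- The involution `i ↦ i*` of the simple roots, `α_{i*} = -w₀ α_i`. -/
def dualIndex (i : b.support) : b.support := (exists_longest_conj_simpleRefl hw₀ i).choose

omit [Module.Free ℤ Λ] in
lemma longest_conj_simpleRefl (i : b.support) :
    w₀ * simpleRefl b i * w₀ = simpleRefl b (dualIndex hw₀ i) :=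
  (exists_longest_conj_simpleRefl hw₀ i).choose_spec.1

omit [Module.Free ℤ Λ] in
lemma root_dualIndex (i : b.support) : P.root (dualIndex hw₀ i) = -(w₀ • P.root i) :=
  (exists_longest_conj_simpleRefl hw₀ i).choose_spec.2

omit [Module.Free ℤ Λ] in
lemma dualIndex_injective : Function.Injective (dualIndex hw₀) := by
  intro i j hij
  have h := root_dualIndex hw₀ i
  rw [hij, root_dualIndex, neg_inj, smul_left_cancel_iff] at h
  exact Subtype.ext (P.root.injective h.symm)

omit [Module.Free ℤ Λ] in
lemma wordProd_map_dualIndex (l : List b.support) :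
    wordProd b (l.map (dualIndex hw₀)) = w₀ * wordProd b l * w₀ := by
  induction l with
  | nil => simp [longest_mul_self hw₀]
  | cons i l ih =>
    rw [List.map_cons, wordProd_cons, wordProd_cons, ih, longest_conj_mul hw₀,
      longest_conj_simpleRefl hw₀]

omit [Module.Free ℤ Λ] in
lemma orderOf_dualIndex (i j : b.support) :
    orderOf (simpleRefl b (dualIndex hw₀ i) * simpleRefl b (dualIndex hw₀ j)) =
      orderOf (simpleRefl b i * simpleRefl b j) := by
  rw [← longest_conj_simpleRefl hw₀, ← longest_conj_simpleRefl hw₀, ← longest_conj_mul hw₀]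
  have h : MulAut.conj w₀ (simpleRefl b i * simpleRefl b j) =
      w₀ * (simpleRefl b i * simpleRefl b j) * w₀ := by
    rw [MulAut.conj_apply, longest_inv hw₀]
  rw [← h]
  exact orderOf_injective (MulAut.conj w₀).toMonoidHom (MulAut.conj w₀).injective _

/-- The endomorphism of the Hecke algebra with `h_w ↦ h_{w₀ w w₀}`. -/
def longestHom : Hecke b →ₐ[CoeffRing Λ] Hecke b :=
  diagramHom (dualIndex hw₀) (dualIndex_injective hw₀) (orderOf_dualIndex hw₀)

lemma longestHom_hSimple (i : b.support) :
    longestHom hw₀ (hSimple b i) = hSimple b (dualIndex hw₀ i) :=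
  diagramHom_hSimple b _ _ _ i

lemma longestHom_h (w : P.weylGroup) : longestHom hw₀ (h b w) = h b (w₀ * w * w₀) := by
  have hr := isReducedWord_reducedWord b w
  have hl : IsReducedWord b ((reducedWord b w).map (dualIndex hw₀)) (w₀ * w * w₀) :=
    ⟨by rw [wordProd_map_dualIndex, hr.1], by
      rw [List.length_map, hr.2, length_longest_conj hw₀]⟩
  rw [h_eq_prod hl, h, map_list_prod, List.map_map, List.map_map]
  congr 2
  exact funext fun i ↦ longestHom_hSimple hw₀ i

lemma longestHom_longestHom (x : Hecke b) : longestHom hw₀ (longestHom hw₀ x) = x := by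
  have := finite_weylGroup b
  have := Fintype.ofFinite P.weylGroup
  have h1 : (longestHom hw₀).toLinearMap ∘ₗ (longestHom hw₀).toLinearMap = LinearMap.id :=
    (heckeBasis b).ext fun w ↦ by
      simp [heckeBasis_apply, longestHom_h, longest_conj_conj hw₀]
  exact congr($h1 x)

/-- The automorphism `Ω` of the Hecke algebra, `Ω(h_w) = h_{w₀ w w₀}`. -/
def longestEquiv : Hecke b ≃ₐ[CoeffRing Λ] Hecke b :=
  AlgEquiv.ofAlgHom (longestHom hw₀) (longestHom hw₀)
    (AlgHom.ext (longestHom_longestHom hw₀)) (AlgHom.ext (longestHom_longestHom hw₀))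

theorem longestHom_Y (v : P.weylGroup) :
    longestHom hw₀ (Y b (w₀ * v * w₀)) =
      onCoeffs b (star Λ) (onCoeffs b (weylAct w₀) (Y b v)) := by
  induction hn : length b v using Nat.strong_induction_on generalizing v with
  | _ n ih =>
    by_cases hv : v = 1
    · have h1 : Y b (1 : P.weylGroup) = 1 := by
        rw [Y, dif_neg]
        simp
      rw [hv, mul_one, longest_mul_self hw₀, h1, map_one, map_one, map_one]
    · obtain ⟨i, hi⟩ := exists_not_isPos_smul b hv
      have hlen := length_mul_simpleRefl_of_not_isPos b hi
      have hconj : w₀ * v * w₀ * simpleRefl b (dualIndex hw₀ i) =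
          w₀ * (v * simpleRefl b i) * w₀ := by
        rw [longest_conj_mul hw₀, longest_conj_simpleRefl hw₀]
      -- Conjugation by w₀ preserves length, so descents i of v match descents i* of w₀vw₀.
      -- `Y_eq_mul` lets both sides be unfolded along this matched pair.
      have hi' : ¬ b.IsPos ((w₀ * v * w₀) • ((dualIndex hw₀ i : b.support) : ι)) := by
        rw [← length_mul_simpleRefl_lt_iff, hconj, length_longest_conj hw₀,
          length_longest_conj hw₀]
        lia
      have hroot : (w₀ * (v * simpleRefl b i) * w₀) • P.root (dualIndex hw₀ i) =
          -(w₀ • (v * simpleRefl b i) • P.root i) := by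
        rw [root_dualIndex, smul_neg, ← mul_smul, mul_assoc, longest_mul_self hw₀, mul_one,
          mul_smul]
      have hΩ : longestHom hw₀ (hSimple b (dualIndex hw₀ i)) = hSimple b i := by
        rw [← longestHom_hSimple hw₀, longestHom_longestHom]
      rw [Y_eq_mul b hi, Y_eq_mul b hi', hconj, hroot, map_mul, ih _ (by lia) _ rfl, map_add, hΩ,
        AlgHom.commutes, map_mul, map_mul, map_add, map_add, onCoeffs_hSimple, onCoeffs_hSimple,
        onCoeffs_algebraMap, onCoeffs_algebraMap, weylAct_shift, star_shift]

end LongestElement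

end YangBaxter

end

theorem proposition2 {ι Λ Λ' : Type*} [Finite ι]
    [AddCommGroup Λ] [Module.Free ℤ Λ] [Module.Finite ℤ Λ]
    [AddCommGroup Λ'] [Module.Free ℤ Λ'] [Module.Finite ℤ Λ']
    (P : RootDatum ι Λ Λ') [P.IsReduced] (b : P.Base)
    (hss : b.support.card = Module.finrank ℤ Λ)
    (w₀ : P.weylGroup) (hw₀ : ∀ w, YangBaxter.length b w ≤ YangBaxter.length b w₀) :
    ∃ (B : Module.Basis P.weylGroup (YangBaxter.CoeffRing Λ) (YangBaxter.Hecke b))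
      (Ω : YangBaxter.Hecke b ≃ₐ[YangBaxter.CoeffRing Λ] YangBaxter.Hecke b),
      (∀ w, B w = YangBaxter.h b w) ∧
      (∀ w, Ω (YangBaxter.h b w) = YangBaxter.h b (w₀ * w * w₀)) ∧
      (∀ v, Ω (YangBaxter.Y b (w₀ * v * w₀)) =
        YangBaxter.onCoeffs b (YangBaxter.star Λ)
          (YangBaxter.onCoeffs b (YangBaxter.weylAct w₀) (YangBaxter.Y b v))) ∧
      (∀ w v, B.repr (YangBaxter.Y b (w₀ * v * w₀)) (w₀ * w * w₀) =
        YangBaxter.star Λ (YangBaxter.weylAct w₀ (B.repr (YangBaxter.Y b v) w))) := by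
  have := YangBaxter.finite_weylGroup b
  have := Fintype.ofFinite P.weylGroup
  set B := YangBaxter.heckeBasis b
  have hB : ∀ w, B w = YangBaxter.h b w := YangBaxter.heckeBasis_apply b
  have hΩ : ∀ w, YangBaxter.longestEquiv hw₀ (YangBaxter.h b w) = YangBaxter.h b (w₀ * w * w₀) :=
    YangBaxter.longestHom_h hw₀
  have hY : ∀ v, YangBaxter.longestEquiv hw₀ (YangBaxter.Y b (w₀ * v * w₀)) =
      YangBaxter.onCoeffs b (YangBaxter.star Λ)
        (YangBaxter.onCoeffs b (YangBaxter.weylAct w₀) (YangBaxter.Y b v)) :=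
    YangBaxter.longestHom_Y hw₀
  refine ⟨B, YangBaxter.longestEquiv hw₀, hB, hΩ, hY, fun w v ↦ ?_⟩
  -- Ω permutes the basis by the involution u ↦ w₀uw₀, so it permutes coordinates in the same way.
  have hconj : ∀ x : YangBaxter.Hecke b,
      B.repr (YangBaxter.longestEquiv hw₀ x) w = B.repr x (w₀ * w * w₀) := by
    intro x
    have h1 : (Finsupp.lapply w ∘ₗ B.repr.toLinearMap) ∘ₗ
        (YangBaxter.longestEquiv hw₀).toLinearMap =
        Finsupp.lapply (w₀ * w * w₀) ∘ₗ B.repr.toLinearMap := B.ext fun u ↦ by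
      have h2 : w₀ * u * w₀ = w ↔ u = w₀ * w * w₀ := by
        constructor <;> rintro rfl <;> rw [YangBaxter.longest_conj_conj hw₀]
      have h3 : YangBaxter.longestEquiv hw₀ (B u) = B (w₀ * u * w₀) := by rw [hB, hΩ, hB]
      classical
      simp [h3, Finsupp.single_apply, h2]
    exact congr($h1 x)
  have hcoeff : ∀ (f : YangBaxter.CoeffRing Λ →ₐ[YangBaxter.ParamRing] YangBaxter.CoeffRing Λ)
      (x : YangBaxter.Hecke b), B.repr (YangBaxter.onCoeffs b f x) w = f (B.repr x w) := by
    intro f x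
    have h1 : YangBaxter.onCoeffs b f x = ∑ u, f (B.repr x u) • B u := by
      conv_lhs => rw [← B.sum_repr x]
      simp only [map_sum, YangBaxter.onCoeffs_smul, hB, YangBaxter.onCoeffs_h]
    classical
    rw [h1, B.repr_sum_self]
  rw [← hconj, hY, hcoeff, hcoeff]
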